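/- Let $S$ be a set of $n$ points in the plane, not all on one line. A \emph{polygonization} of $S$ is a simple polygon with vertex set $S$. A \emph{polygonal wrap} of $S$ is a cyclic sequence $\sigma$ of points of $S$ in which every point of $S$ occurs, possibly repeatedly, such that for every $\varepsilon>0$ the occurrences of the points that occur at least twice (the points of \emph{double contact}) can be moved by at most $\varepsilon$, each separately, so that the closed polygon through the sequence becomes simple. \textsc{Twang}$(abc)$ is defined for three consecutive entries $a,b,c$ of such a sequence $\sigma$ (which may also contain auxiliary points not in $S$, called pseudovertices) if (1) $a,b,c$ are not collinear, or $a=c\ne b$ (then $b$ is a hairpin vertex), and (2) $b$ is a pseudovertex, or $b$ is a point of double contact and $\triangle abc$ contains no nested double contact at $b$, i.e. for arbitrarily small perturbations that make the polygon simple, the (perturbed) closed triangle $abc$ contains no other occurrence of $b$. It replaces $a,b,c$ in $\sigma$ by $\mathrm{sp}(abc)$, the sequence of all entries of $\sigma$ that lie along the shortest path from $a$ to $c$ that stays inside the closed triangle $abc$ and does not cross the polygon. Here a polygonal path from $a$ to $c$ \emph{does not cross} the polygon if for arbitrarily small perturbations that make the polygon simple, an arbitrarily close path, inside the perturbed triangle,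 meets the perturbed polygon only in its two endpoints. A \emph{twang cascade} started at a polygonal wrap repeatedly performs any defined \textsc{Twang}$(abc)$ at a point $b$ of double contact, as long as there is one. A \emph{forward move} on a polygonization $P$ of $S$ is given by a vertex $v$ with neighbours $u,w$ such that $u,v,w$ are not collinear, and an edge $ab$ of $P$ with points $a,x^-,x,x^+,b$ in this order on it, all different, such that $v$ sees each of $y=x^-,x,x^+$ (the segment $vy$ meets the boundary of $P$ only in $v$ and $y$) and $x^-,x^+$ lie on the reflex side of $v$ (not in the convex angle $uvw$ at $v$). It consists of three steps: replace $a,b$ by $a,x^-,v,x^+,b$ and then perform \textsc{Twang}$(ax^-v)$ and \textsc{Twang}$(vx^+b)$, in which $x^\pm$ are pseudovertices; perform \textsc{Twang}$(uvw)$; perform a twang cascade. \textbf{Corollary.} Every twang cascade consists of at most $O(n^n)$ twangs. Precisely: (i) There is a constant $C$ such that for every finite non-collinear point set $S$, with $n=|S|$, the twang cascade of any forward move on any polygonization of $S$ consists of at most $Cn^n$ twangs, whatever choices are made in it. (ii) For every $K$ there is a constant $C_K$ such that for every finite non-collinear point set $S$, with $n=|S|$, every twang cascade that starts at a polygonal wrap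 of $S$ in which each point occurs at most $K$ times consists of at most $C_K n^n$ twangs. -/

import Mathlib

namespace Polygonization

/-- Points of the plane. -/
abbrev Pt := EuclideanSpace ℝ (Fin 2)

/-! ### Closed polygons and polygonal paths, given by their vertex lists -/

/-- The edges of the closed polygon with cyclic vertex list `l`. -/
def cycEdges (l : List Pt) : List (Pt × Pt) := l.zip (l.rotate 1)

/-- The boundary of the closed polygon with cyclic vertex list `l`. -/
def boundary (l : List Pt) : Set Pt := {x | ∃ e ∈ cycEdges l, x ∈ segment ℝ e.1 e.2}

/-- An edge without its terminal endpoint. -/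
def halfOpenEdge (e : Pt × Pt) : Set Pt := AffineMap.lineMap (k := ℝ) e.1 e.2 '' Set.Ico (0 : ℝ) 1

/-- The closed polygon `l` is simple: the closed curve that runs through its vertices in cyclic
order does not meet itself (the half-open edges, which partition the curve, are disjoint). -/
def IsSimplePolygon (l : List Pt) : Prop :=
  3 ≤ l.length ∧ (cycEdges l).Pairwise fun e f => Disjoint (halfOpenEdge e) (halfOpenEdge f)

/-- A polygonization of `S`: a simple polygon with vertex set `S`. -/
def IsPolygonization (S : Finset Pt) (P : List Pt) : Prop :=
  (∀ p, p ∈ P ↔ p ∈ S) ∧ IsSimplePolygon P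

/-- The set of points on the (open) polygonal path with vertex list `l`. -/
def pathCarrier (l : List Pt) : Set Pt :=
  {x | x ∈ l ∨ ∃ e ∈ l.zip l.tail, x ∈ segment ℝ e.1 e.2}

/-- The length of a polygonal path. -/
noncomputable def pathLength (l : List Pt) : ℝ := ((l.zip l.tail).map fun e => dist e.1 e.2).sum

/-- The closed triangle with corners `a`, `b`, `c`. -/
def triangle (a b c : Pt) : Set Pt := convexHull ℝ {a, b, c}

/-! ### Perturbations and polygonal wraps -/

/-- `l'` arises from `l` by moving every entry (every occurrence separately) by at most `ε`. -/
def IsPerturbation (ε : ℝ) (l l' : List Pt) : Prop := List.Forall₂ (fun p q => dist p q ≤ ε) l l'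

/-- A point of double contact: it occurs at least twice in the sequence. -/
def IsDoubleContact (σ : List Pt) (p : Pt) : Prop := List.Duplicate p σ

open Classical in
/-- The number of occurrences of a point in a sequence. -/
noncomputable def occurrences (σ : List Pt) (p : Pt) : ℕ := σ.count p

/-- A polygonal wrap of `S`: a cyclic sequence in which exactly the points of `S` occur, possibly
repeatedly, and which becomes a simple polygon by arbitrarily small perturbations of the
occurrences of its points of double contact. -/
def IsPolygonalWrap (S : Finset Pt) (σ : List Pt) : Prop :=
  (∀ p, p ∈ σ ↔ p ∈ S) ∧
  ∀ ε > 0, ∃ σ', IsPerturbation ε σ σ' ∧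
    List.Forall₂ (fun p q => ¬ IsDoubleContact σ p → q = p) σ σ' ∧ IsSimplePolygon σ'

/-! ### Twangs

The cyclic sequence under consideration is `a :: b :: c :: rest`, up to rotation. -/

/-- `ρ` is a polygonal path from `a` to `c` that stays inside the triangle `abc`. -/
def IsPathInTriangle (a b c : Pt) (ρ : List Pt) : Prop :=
  ρ.head? = some a ∧ ρ.getLast? = some c ∧ pathCarrier ρ ⊆ triangle a b c

/-- The path `ρ` from `a` to `c` stays inside the triangle `abc` and does not cross the weakly
simple closed polygon `a :: b :: c :: rest`: after arbitrarily small perturbations that make the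
polygon simple, the path, still inside the triangle, meets the polygon in its endpoints only.
(Vertices of `ρ` may be repeated, so that the perturbed path can pass around several
perturbed occurrences of one point.) -/
def IsNonCrossingPath (a b c : Pt) (rest ρ : List Pt) : Prop :=
  IsPathInTriangle a b c ρ ∧
  ∀ ε > 0, ∃ (a' b' c' : Pt) (rest' ρ' : List Pt),
    IsPerturbation ε (a :: b :: c :: rest) (a' :: b' :: c' :: rest') ∧
    IsSimplePolygon (a' :: b' :: c' :: rest') ∧
    IsPerturbation ε ρ ρ' ∧
    IsPathInTriangle a' b' c' ρ' ∧
    pathCarrier ρ' ∩ boundary (a' :: b' :: c' :: rest') ⊆ {a', c'}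

/-- `ρ` is a shortest path from `a` to `c` that stays inside the triangle `abc` and does not cross
the polygon `a :: b :: c :: rest`. -/
def IsShortestPath (a b c : Pt) (rest ρ : List Pt) : Prop :=
  IsNonCrossingPath a b c rest ρ ∧
  ∀ ρ₁, IsNonCrossingPath a b c rest ρ₁ → pathLength ρ ≤ pathLength ρ₁

open Classical in
/-- `τ` is the sequence `sp(abc)`: the vertices of the polygon along the shortest path from `a` to
`c`, all of them (also those at which the path does not bend), in their order along the path and
without immediate repetitions. -/
def IsSp (a b c : Pt) (rest τ : List Pt) : Prop :=
  ∃ ρ, IsShortestPath a b c rest ρ ∧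
    (∀ p ∈ ρ, p ∈ a :: b :: c :: rest) ∧
    (∀ p ∈ a :: b :: c :: rest, p ∈ pathCarrier ρ → p ∈ ρ) ∧
    τ = ρ.destutter (· ≠ ·)

/-- The triangle `abc` contains no nested double contact at `b`: after (arbitrarily small)
perturbations that make the polygon simple, the triangle contains no other occurrence of `b`. -/
def NoNestedContact (a b c : Pt) (rest : List Pt) : Prop :=
  ∀ ε > 0, ∃ (a' b' c' : Pt) (rest' : List Pt),
    IsPerturbation ε (a :: b :: c :: rest) (a' :: b' :: c' :: rest') ∧
    IsSimplePolygon (a' :: b' :: c' :: rest') ∧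
    List.Forall₂ (fun p q => p = b → q ∉ triangle a' b' c') rest rest'

/-- `σ'` results from `σ` by the operation Twang(`abc`). The vertices of `σ` that are not in `S`
are its pseudovertices. The case `a = c` is that of a hairpin vertex `b`. -/
def IsTwang (S : Finset Pt) (σ : List Pt) (a b c : Pt) (σ' : List Pt) : Prop :=
  ∃ rest τ : List Pt, σ.IsRotated (a :: b :: c :: rest) ∧
    (¬ Collinear ℝ {a, b, c} ∨ (a = c ∧ a ≠ b)) ∧
    (b ∉ S ∨ (IsDoubleContact σ b ∧ NoNestedContact a b c rest)) ∧
    IsSp a b c rest τ ∧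
    σ' = τ ++ rest

/-- `f 0, f 1, …, f T` is a run of `T` steps of a twang cascade: each step is a twang at a point
of double contact. -/
def IsTwangCascade (S : Finset Pt) (T : ℕ) (f : ℕ → List Pt) : Prop :=
  ∀ i < T, ∃ a b c, IsDoubleContact (f i) b ∧ IsTwang S (f i) a b c (f (i + 1))

/-! ### Stretches and forward moves -/

/-- `v` clearly sees the boundary point `y` of `P`. -/
def Sees (P : List Pt) (v y : Pt) : Prop := segment ℝ v y ∩ boundary P = {v, y}

/-- `xm`, `xp` are admissible pseudovertices for stretching the edge `ab` of `P` to the vertex `v`: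
they lie inside `ab`, on the two sides of a point `x`, with `xm` closer to `a`, and `v` clearly
sees all three points. -/
def ArePseudovertices (P : List Pt) (a b v xm xp : Pt) : Prop :=
  ∃ x, Sbtw ℝ a x b ∧ Sbtw ℝ a xm x ∧ Sbtw ℝ x xp b ∧ Sees P v x ∧ Sees P v xm ∧ Sees P v xp

/-- `σ` results from the polygon `P` by Stretch(`ab`, `v`) with the pseudovertices `xm`, `xp`: the
edge `ab` is replaced by `a, xm, v, xp, b`, and then Twang(`a xm v`) and Twang(`v xp b`) remove
the pseudovertices. -/
def IsStretch (S : Finset Pt) (P : List Pt) (a b v xm xp : Pt) (σ : List Pt) : Prop :=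
  v ∈ P ∧ ArePseudovertices P a b v xm xp ∧
  ∃ rest σ₁ : List Pt, P.IsRotated (a :: b :: rest) ∧
    IsTwang S (a :: xm :: v :: xp :: b :: rest) a xm v σ₁ ∧
    IsTwang S σ₁ v xp b σ

/-- For consecutive noncollinear vertices `u`, `v`, `w`: the direction from `v` to `y` points to the
reflex side of `v`, that is, not into the convex angle `uvw`. -/
def OnReflexSide (u v w y : Pt) : Prop :=
  ¬ ∃ s t : ℝ, 0 ≤ s ∧ 0 ≤ t ∧ y - v = s • (u - v) + t • (w - v)

/-- `σ` is the polygonal wrap to which a forward move on the polygon `P` applies its twang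
cascade: Stretch(`ab`, `v`) has been executed, with the pseudovertices on the reflex side of the
noncollinear vertex `v`, and then Twang(`uvw`), where `u, v, w` are consecutive in `P`. -/
def IsCascadeStart (S : Finset Pt) (P σ : List Pt) : Prop :=
  ∃ (a b u v w xm xp : Pt) (rest σ₁ : List Pt),
    P.IsRotated (u :: v :: w :: rest) ∧ ¬ Collinear ℝ {u, v, w} ∧
    OnReflexSide u v w xm ∧ OnReflexSide u v w xp ∧
    IsStretch S P a b v xm xp σ₁ ∧
    IsTwang S σ₁ u v w σ

end Polygonization

/-! The potential is a total crossing number. For every subset `A` cut out by a line through no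
point of `S`, count the edges of the cyclic sequence with exactly one endpoint in `A`
(`cycCrossings`), and add up over all such `A` (`dichotomies`). By Radon's theorem lines shatter no
four points, so Sauer–Shelah leaves at most 4n³ sets `A` (`card_dichotomies_le`). If each point
occurs at most K times, the sequence has at most Kn edges, so the potential starts at no more than
4Kn⁴. This polynomial bound is stronger than the claim, since n⁴ ≤ 4nⁿ.

Every twang of a cascade lowers the potential. No single count grows, because a shortest path in the
triangle `abc` is convex towards `b` and so changes sides of a line no more often than `ab` and `bc`
do (`IsShortestPath.pairSum_sep_le`). Some count drops: in the absence of a nested contact the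
corner at `b` can be cut off, so the shortest path avoids `b` (`IsShortestPath.notMem`), and a line
just below `b` is no longer crossed (`IsTwang.exists_cycCrossings_lt`).

Convexity is the hard part, since a non-crossing path is known only through perturbations, and its
perturbed copies need not be simple. If the direct path `ac` is non-crossing, the shortest path is
straight; if some shortcut is non-crossing, it may be taken. Otherwise one fine perturbation admits
none of them (`false_of_no_shortcut`). There, two path vertices that minimize the same functional,
smallest at `b`, span a segment that the polygon meets at most in the ends of the path
(`segment_inter_boundary`): the rest of the polygon is connected and avoids both `ρ` and `a, b, c`,
so the difference of their angle sums is constant along it (`angSum_sub_eq`); it vanishes on the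
side `ac` but not on that segment. Hence the path follows its lower hull in barycentric coordinates
without skipping a vertex, which excludes the forbidden alternation (`not_separated_of_noSkip`).

For a forward move, the same counts, over `S` enlarged by the two pseudovertices, are followed
through the three twangs before the cascade (`IsCascadeStart.exists_superset`). -/

namespace Polygonization

/-! ### Sums over the consecutive pairs of a list -/

/-- The sum of `w x y` over the pairs of consecutive entries `x`, `y` of a list. -/
def pairSum {α β : Type*} [AddCommMonoid β] (w : α → α → β) : List α → β
  | [] => 0
  | [_] => 0
  | x :: y :: l => w x y + pairSum w (y :: l)

section pairSum
variable {α β : Type*} [AddCommMonoid β] (w : α → α → β)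

@[simp] lemma pairSum_nil : pairSum w [] = 0 := rfl
@[simp] lemma pairSum_singleton (x : α) : pairSum w [x] = 0 := rfl
@[simp] lemma pairSum_cons_cons (x y : α) (l : List α) :
    pairSum w (x :: y :: l) = w x y + pairSum w (y :: l) := rfl

lemma pairSum_eq_sum_zip_tail (l : List α) :
    pairSum w l = ((l.zip l.tail).map fun e => w e.1 e.2).sum := by
  induction l with
  | nil => simp
  | cons x l ih =>
    cases l with
    | nil => simp
    | cons y l => simpa using congrArg (w x y + ·) ih

lemma sum_zip_append_singleton (x : α) (l : List α) (y : α) :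
    (((x :: l).zip (l ++ [y])).map fun e => w e.1 e.2).sum = pairSum w (x :: (l ++ [y])) := by
  induction l generalizing x with
  | nil => simp
  | cons z l ih => simpa using congrArg (w x z + ·) (ih z)

lemma pairSum_append_cons (l₁ : List α) (p : α) (l₂ : List α) :
    pairSum w (l₁ ++ p :: l₂) = pairSum w (l₁ ++ [p]) + pairSum w (p :: l₂) := by
  induction l₁ with
  | nil => simp
  | cons x l ih =>
    cases l with
    | nil => simp
    | cons y l =>
      simp only [List.cons_append, pairSum_cons_cons] at ih ⊢
      rw [ih, add_assoc]

/-- A weight that vanishes on the diagonal does not see immediate repetitions, so crossings of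
`sp(abc)` can be counted on the underlying path. -/
lemma pairSum_destutter [DecidableRel fun x y : α => x ≠ y] (hw : ∀ x, w x x = 0) (l : List α) :
    pairSum w (l.destutter (· ≠ ·)) = pairSum w l := by
  have key : ∀ (l : List α) (x : α), pairSum w (l.destutter' (· ≠ ·) x) = pairSum w (x :: l) ∧
      ∃ l', l.destutter' (· ≠ ·) x = x :: l' := by
    intro l
    induction l with
    | nil => intro x; simp
    | cons y l ih =>
      intro x
      by_cases h : x = y
      · subst h
        have := ih x
        simpa [List.destutter', hw] using this
      · obtain ⟨h1, l', h2⟩ := ih y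
        rw [h2] at h1
        simp [List.destutter', h, h2, ← h1]
  cases l with
  | nil => simp
  | cons x l => exact (key l x).1

end pairSum

lemma head?_destutter_ne {α : Type*} [DecidableRel fun x y : α => x ≠ y] (l : List α) :
    (l.destutter (· ≠ ·)).head? = l.head? := by
  have key : ∀ (l : List α) (x : α), (l.destutter' (· ≠ ·) x).head? = some x := by
    intro l
    induction l with
    | nil => intro x; simp
    | cons y l ih =>
      intro x
      by_cases h : x = y
      · subst h; simpa [List.destutter'] using ih x
      · simp [List.destutter', h]
  cases l with
  | nil => simp
  | cons x l => exact key l x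

lemma getLast?_destutter_ne {α : Type*} [DecidableRel fun x y : α => x ≠ y] (l : List α) :
    (l.destutter (· ≠ ·)).getLast? = l.getLast? := by
  have key : ∀ (l : List α) (x : α),
      (l.destutter' (· ≠ ·) x).getLast? = (x :: l).getLast? := by
    intro l
    induction l with
    | nil => intro x; simp
    | cons y l ih =>
      intro x
      by_cases h : x = y
      · subst h; simpa [List.destutter'] using ih x
      · have := ih y
        simp only [List.destutter', ne_eq, h, not_false_eq_true, if_true]
        rw [List.getLast?_cons, this, List.getLast?_cons_cons]
        simp [List.getLast?_cons]
  cases l with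
  | nil => simp
  | cons x l => exact key l x

lemma pathLength_eq_pairSum (l : List Pt) : pathLength l = pairSum dist l :=
  (pairSum_eq_sum_zip_tail dist l).symm

lemma dist_le_pairSum (x : Pt) (l : List Pt) (y : Pt) :
    dist x y ≤ pairSum dist (x :: (l ++ [y])) := by
  induction l generalizing x with
  | nil => simp
  | cons z l ih => simpa using (dist_triangle x z y).trans (add_le_add_right (ih z) _)

/-! ### Crossing numbers -/

open Classical in
/-- `1` if exactly one of `p`, `q` lies in `A`, and `0` otherwise. -/
noncomputable def sep (A : Set Pt) (p q : Pt) : ℕ := if (p ∈ A ↔ q ∈ A) then 0 else 1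

lemma sep_self (A : Set Pt) (p : Pt) : sep A p p = 0 := by simp [sep]

lemma sep_eq_zero {A : Set Pt} {p q : Pt} (h : p ∈ A ↔ q ∈ A) : sep A p q = 0 := by simp [sep, h]

lemma sep_eq_one {A : Set Pt} {p q : Pt} (h : ¬ (p ∈ A ↔ q ∈ A)) : sep A p q = 1 := by simp [sep, h]

lemma sep_le_one (A : Set Pt) (p q : Pt) : sep A p q ≤ 1 := by unfold sep; split <;> simp

lemma sep_triangle (A : Set Pt) (p q r : Pt) : sep A p r ≤ sep A p q + sep A q r := by
  unfold sep; split_ifs <;> simp; tauto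

/-- The number of edges of the closed polygon `l` that have exactly one endpoint in `A`. -/
noncomputable def cycCrossings (A : Set Pt) (l : List Pt) : ℕ :=
  ((cycEdges l).map fun e => sep A e.1 e.2).sum

lemma cycCrossings_cons (A : Set Pt) (x : Pt) (l : List Pt) :
    cycCrossings A (x :: l) = pairSum (sep A) (x :: (l ++ [x])) := by
  simp [cycCrossings, cycEdges, sum_zip_append_singleton]

lemma cycCrossings_le_length (A : Set Pt) (l : List Pt) : cycCrossings A l ≤ l.length := by
  have : ∀ l : List (Pt × Pt), (l.map fun e => sep A e.1 e.2).sum ≤ l.length := by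
    intro l
    induction l with
    | nil => simp
    | cons e l ih => have := sep_le_one A e.1 e.2; simp; omega
  simpa [cycCrossings, cycEdges] using this (cycEdges l)

lemma cycEdges_rotate (l : List Pt) (n : ℕ) : cycEdges (l.rotate n) = (cycEdges l).rotate n := by
  simp only [cycEdges, List.zip, List.rotate_rotate]
  rw [List.zipWith_rotate_distrib _ _ _ _ (by simp), List.rotate_rotate, add_comm]

lemma cycEdges_perm {l l' : List Pt} (h : l.IsRotated l') : (cycEdges l).Perm (cycEdges l') := by
  obtain ⟨n, rfl⟩ := h
  rw [cycEdges_rotate]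
  exact (List.rotate_perm _ _).symm

lemma cycCrossings_congr (A : Set Pt) {l l' : List Pt} (h : l.IsRotated l') :
    cycCrossings A l = cycCrossings A l' :=
  ((cycEdges_perm h).map _).sum_eq

lemma pairSum_sep_eq_zero {A : Set Pt} {b : Pt} {l : List Pt} (h : ∀ p ∈ l, p ∈ A ↔ b ∈ A) :
    pairSum (sep A) l = 0 := by
  induction l with
  | nil => rfl
  | cons x l ih =>
    cases l with
    | nil => rfl
    | cons y l =>
      simp only [List.forall_mem_cons] at h
      simp [sep_eq_zero (h.1.trans h.2.1.symm), ih (by simpa using h.2)]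

/-- The vertices on the side of `b` form a block, so the path changes sides at most once before it
and once after it. Each change is paid for by an endpoint off the side of `b`. -/
lemma pairSum_sep_le {A : Set Pt} {b : Pt} {x y : Pt} {l : List Pt}
    (hx : l.head? = some x) (hy : l.getLast? = some y)
    (h : ∀ p q r, [p, q, r].Sublist l → (p ∈ A ↔ b ∈ A) → (r ∈ A ↔ b ∈ A) → (q ∈ A ↔ b ∈ A)) :
    pairSum (sep A) l ≤ sep A x b + sep A b y := by
  induction l generalizing x with
  | nil => simp at hx
  | cons z l ih =>
    obtain rfl : z = x := by simpa using hx
    cases l with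
    | nil => simp
    | cons w l =>
      have hy' : (w :: l).getLast? = some y := by simpa using hy
      have ih := ih (x := w) rfl hy' (fun p q r hs => h p q r (hs.cons _))
      rw [pairSum_cons_cons]
      by_cases hz : z ∈ A ↔ b ∈ A
      · by_cases hw : w ∈ A ↔ b ∈ A
        · rw [sep_eq_zero (hz.trans hw.symm), sep_eq_zero hz]
          rw [sep_eq_zero hw] at ih
          omega
        -- Having left the side of `b`, the path cannot return, so the remaining part has no
        -- crossing.
        · have hall : ∀ p ∈ w :: l, p ∈ A ↔ w ∈ A := by
            intro p hp
            rcases List.mem_cons.1 hp with rfl | hp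
            · rfl
            · have := h z w p (.cons_cons _ (.cons_cons _ (List.singleton_sublist.2 hp))) hz
              tauto
          have hyw := hall y (List.mem_of_getLast? hy')
          rw [pairSum_sep_eq_zero hall, sep_eq_one (p := b) (q := y) (by tauto)]
          have := sep_le_one A z w
          omega
      · by_cases hw : w ∈ A ↔ b ∈ A
        · rw [sep_eq_one hz]
          rw [sep_eq_zero hw] at ih
          have := sep_le_one A z w
          omega
        · rw [sep_eq_zero (p := z) (q := w) (by tauto), sep_eq_one hz]
          rw [sep_eq_one hw] at ih
          omega

/-! ### Lower hulls of planar sequences -/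

/-- Among the points `(s j, t j)`, `j ≤ N`, the `i`-th one minimizes the functional
`r * s + (1 - r) * t`. -/
def IsLowest (s t : ℕ → ℝ) (N : ℕ) (r : ℝ) (i : ℕ) : Prop :=
  i ≤ N ∧ ∀ j ≤ N, r * s i + (1 - r) * t i ≤ r * s j + (1 - r) * t j

section hull
variable {s t : ℕ → ℝ} {N : ℕ}

lemma isClosed_isLowest (i : ℕ) : IsClosed {r | IsLowest s t N r i} := by
  simp only [IsLowest, Set.ofPred_and, Set.ofPred_forall]
  exact isClosed_const.inter (isClosed_iInter fun j => isClosed_iInter fun _ =>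
    isClosed_le (by fun_prop) (by fun_prop))

lemma exists_isLowest (r : ℝ) : ∃ i, IsLowest s t N r i := by
  obtain ⟨i, hi, h⟩ := Finset.exists_min_image (Finset.range (N + 1))
    (fun i => r * s i + (1 - r) * t i) ⟨0, by simp⟩
  exact ⟨i, by simpa [Nat.lt_succ_iff] using hi, fun j hj => h j (by simp; omega)⟩

/-- Against each competitor the difference of values is affine in the parameter. -/
lemma IsLowest.of_mem_Icc {r₁ r₂ r : ℝ} {i : ℕ} (h₁ : IsLowest s t N r₁ i)
    (h₂ : IsLowest s t N r₂ i) (hr : r ∈ Set.Icc r₁ r₂) : IsLowest s t N r i := by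
  refine ⟨h₁.1, fun j hj => ?_⟩
  rcases hr.1.eq_or_lt with rfl | h
  · exact h₁.2 j hj
  · have hlt : 0 < r₂ - r₁ := by linarith [hr.2]
    have e₁ := mul_le_mul_of_nonneg_left (h₁.2 j hj) (sub_nonneg.2 hr.2)
    have e₂ := mul_le_mul_of_nonneg_left (h₂.2 j hj) (sub_nonneg.2 hr.1)
    by_contra! hc
    have := mul_lt_mul_of_pos_left hc hlt
    nlinarith

lemma isClosed_exists_isLowest (P : ℕ → Prop) :
    IsClosed {r | ∃ i, P i ∧ IsLowest s t N r i} := by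
  have : {r | ∃ i, P i ∧ IsLowest s t N r i} =
      ⋃ i ∈ {i | P i ∧ i ≤ N}, {r | IsLowest s t N r i} := by
    ext r
    simp only [Set.mem_ofPred_eq, Set.mem_iUnion, exists_prop]
    exact ⟨fun ⟨i, h, h'⟩ => ⟨i, ⟨h, h'.1⟩, h'⟩, fun ⟨i, h, h'⟩ => ⟨i, h.1, h'⟩⟩
  rw [this]
  exact ((Set.finite_le_nat N).subset fun i hi => hi.2).isClosed_biUnion
    fun i _ => isClosed_isLowest i

/-- No index strictly between two simultaneously lowest indices is skipped. -/
def NoSkip (s t : ℕ → ℝ) (N : ℕ) : Prop :=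
  ∀ r ∈ Set.Icc (0 : ℝ) 1, ∀ p j q, p < j → j < q → IsLowest s t N r p → ¬ IsLowest s t N r q

/-- If `j` were never lowest, the parameters with a lowest index below `j` and those with one above
`j` would be two closed sets covering the interval. By connectedness they meet, and there `j` is
skipped. -/
lemma exists_isLowest_between (H : NoSkip s t N) {u v : ℝ} (hu : 0 ≤ u) (hv : v ≤ 1) (huv : u ≤ v)
    {p j q : ℕ} (hp : p < j) (hq : j < q) (hup : IsLowest s t N u p) (hvq : IsLowest s t N v q) :
    ∃ r ∈ Set.Icc u v, IsLowest s t N r j := by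
  by_contra! hc
  have := isPreconnected_closed_iff.1 (isPreconnected_Icc (a := u) (b := v))
    _ _ (isClosed_exists_isLowest (s := s) (t := t) (N := N) (· < j))
    (isClosed_exists_isLowest (s := s) (t := t) (N := N) (j < ·))
    (fun r hr => by
      obtain ⟨i, hi⟩ := exists_isLowest (s := s) (t := t) (N := N) r
      rcases lt_trichotomy i j with h | rfl | h
      · exact Or.inl ⟨i, h, hi⟩
      · exact absurd hi (hc r hr)
      · exact Or.inr ⟨i, h, hi⟩)
    ⟨u, ⟨le_rfl, huv⟩, p, hp, hup⟩ ⟨v, ⟨huv, le_rfl⟩, q, hq, hvq⟩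
  obtain ⟨r, hr, ⟨i, hi, hi'⟩, k, hk, hk'⟩ := this
  exact H r ⟨hu.trans hr.1, hr.2.trans hv⟩ i j k hi hk hi' hk'

variable (H : NoSkip s t N) (h0 : IsLowest s t N 0 0) (h1 : IsLowest s t N 1 N)
include H h0 h1

lemma exists_isLowest_index {j : ℕ} (hj : j ≤ N) : ∃ r ∈ Set.Icc (0 : ℝ) 1, IsLowest s t N r j := by
  rcases Nat.eq_zero_or_pos j with rfl | hpos
  · exact ⟨0, by simp, h0⟩
  rcases hj.eq_or_lt with rfl | hlt
  · exact ⟨1, by simp, h1⟩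
  exact exists_isLowest_between H le_rfl le_rfl zero_le_one hpos hlt h0 h1

/-- If the parameters came in the wrong order, `i` and `j` would both be lowest at both of them.
Equal values at two different parameters force equal coordinates. -/
lemma IsLowest.le_or_eq {i j : ℕ} (hij : i < j) {l m : ℝ} (hl : l ∈ Set.Icc (0 : ℝ) 1)
    (hm : m ∈ Set.Icc (0 : ℝ) 1) (hi : IsLowest s t N l i) (hj : IsLowest s t N m j) :
    l ≤ m ∨ (s i = s j ∧ t i = t j) := by
  by_contra! hc
  obtain ⟨hlt, hne⟩ := hc
  have him : IsLowest s t N m i := by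
    rcases Nat.eq_zero_or_pos i with rfl | hpos
    · exact h0.of_mem_Icc hi ⟨hm.1, hlt.le⟩
    · obtain ⟨r, hr, h⟩ := exists_isLowest_between H le_rfl hm.2 hm.1 hpos hij h0 hj
      exact h.of_mem_Icc hi ⟨hr.2, hlt.le⟩
  have hjl : IsLowest s t N l j := by
    rcases hj.1.eq_or_lt with rfl | hlt'
    · exact hj.of_mem_Icc h1 ⟨hlt.le, hl.2⟩
    · obtain ⟨r, hr, h⟩ := exists_isLowest_between H hl.1 le_rfl hl.2 hij hlt' hi h1
      exact hj.of_mem_Icc h ⟨hlt.le, hr.1⟩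
  have e₁ := le_antisymm (hi.2 j hj.1) (hjl.2 i hi.1)
  have e₂ := le_antisymm (him.2 j hj.1) (hj.2 i hi.1)
  have e₃ : (l - m) * ((s i - s j) - (t i - t j)) = 0 := by linear_combination e₁ - e₂
  rcases mul_eq_zero.1 e₃ with h | h
  · linarith
  · have : t i = t j := by linear_combination e₁ - l * h
    exact hne (by linarith) this

/-- The two optimality inequalities, at parameters `l < m`, give the claim. The hypotheses `hs` and
`ht` settle the parameters 0 and 1, where the functional ignores one coordinate. -/
lemma lower_hull_monotone (hs : ∀ i ≤ N, t i = t 0 → s i = s 0) (ht : ∀ i ≤ N, s i = s N → t i = t N)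
    {i j : ℕ} (hij : i < j) (hj : j ≤ N) : s j ≤ s i ∧ t i ≤ t j := by
  obtain ⟨l, hl, hil⟩ := exists_isLowest_index H h0 h1 (hij.le.trans hj)
  obtain ⟨m, hm, hjm⟩ := exists_isLowest_index H h0 h1 hj
  rcases IsLowest.le_or_eq H h0 h1 hij hl hm hil hjm with hlm | h
  swap
  · exact ⟨h.1.ge, h.2.le⟩
  have e₁ := hil.2 j hj
  have e₂ := hjm.2 i hil.1
  rcases hlm.eq_or_lt with rfl | hlt
  · rcases hl.1.eq_or_lt with rfl | hl0
    · have hi0 : t i = t 0 := by linarith [hil.2 0 (Nat.zero_le _), h0.2 i hil.1]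
      have hj0 : t j = t 0 := by linarith [hjm.2 0 (Nat.zero_le _), h0.2 j hj]
      rw [hs i hil.1 hi0, hs j hj hj0, hi0, hj0]
      simp
    rcases hl.2.eq_or_lt with rfl | hl1
    · have hi0 : s i = s N := by linarith [hil.2 N le_rfl, h1.2 i hil.1]
      have hj0 : s j = s N := by linarith [hjm.2 N le_rfl, h1.2 j hj]
      rw [ht i hil.1 hi0, ht j hj hj0, hi0, hj0]
      simp
    -- In the wrong order, `j` loses to `i` at every parameter beyond `l`, so there only indices
    -- above `j` are lowest. By closedness such an index `q` is lowest at `l` as well, and `j` is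
    -- skipped between `i` and `q`.
    by_contra hc
    have hst : s i < s j ∧ t j < t i := by
      rcases lt_or_ge (s i) (s j) with h | h
      · refine ⟨h, ?_⟩
        by_contra! h'
        nlinarith [mul_lt_mul_of_pos_left h hl0]
      · exfalso
        apply hc
        refine ⟨h, ?_⟩
        by_contra! h'
        nlinarith [mul_lt_mul_of_pos_left h' (sub_pos.2 hl1)]
    have hnot : ∀ r, l < r → ¬ IsLowest s t N r j := by
      intro r hr h
      have := h.2 i hil.1
      nlinarith [mul_pos (sub_pos.2 hr) (sub_pos.2 hst.1), mul_pos (sub_pos.2 hr) (sub_pos.2 hst.2)]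
    have hcl := isClosed_exists_isLowest (s := s) (t := t) (N := N) (j < ·)
    have hsub : Set.Ioc l 1 ⊆ {r | ∃ i, j < i ∧ IsLowest s t N r i} := by
      intro r hr
      obtain ⟨p, hp⟩ := exists_isLowest (s := s) (t := t) (N := N) r
      rcases lt_trichotomy p j with h | rfl | h
      · exfalso
        rcases hj.eq_or_lt with rfl | hjN
        · exact hnot 1 hl1 h1
        obtain ⟨u, hu, hu'⟩ :=
          exists_isLowest_between H (hl.1.trans hr.1.le) le_rfl hr.2 h hjN hp h1
        exact hnot u (hr.1.trans_le hu.1) hu'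
      · exact absurd hp (hnot r hr.1)
      · exact ⟨p, h, hp⟩
    have hmem := closure_minimal hsub hcl
    rw [closure_Ioc hl1.ne] at hmem
    obtain ⟨q, hq, hq'⟩ := hmem ⟨le_rfl, hl1.le⟩
    exact H l hl i j q hij hq hil hq'
  · have hd : (m - l) * ((s j - s i) - (t j - t i)) ≤ 0 := by linarith
    have hd' : (s j - s i) ≤ (t j - t i) := by
      by_contra! h
      nlinarith [mul_pos (sub_pos.2 hlt) (sub_pos.2 h)]
    constructor
    · nlinarith [hm.1, hm.2]
    · nlinarith [hl.1, hl.2]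

/-- A sequence that runs along its lower hull has no vertex `j` that a line separates from the
origin, from an earlier and from a later vertex. -/
lemma not_separated_of_noSkip (hs : ∀ i ≤ N, t i = t 0 → s i = s 0)
    (ht : ∀ i ≤ N, s i = s N → t i = t N) (hs0 : ∀ i ≤ N, 0 ≤ s i) (ht0 : ∀ i ≤ N, 0 ≤ t i)
    {i j k : ℕ} (hij : i < j) (hjk : j < k) (hk : k ≤ N) {x y z : ℝ} (hz : 0 < z)
    (hj : z < x * s j + y * t j) (hi : x * s i + y * t i < z) (hk' : x * s k + y * t k < z) :
    False := by
  have hjN := hjk.le.trans hk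
  obtain ⟨a₁, a₂⟩ := lower_hull_monotone H h0 h1 hs ht hij hjN
  obtain ⟨b₁, b₂⟩ := lower_hull_monotone H h0 h1 hs ht hjk hk
  have hsj := hs0 j hjN
  have htj := ht0 j hjN
  rcases le_or_gt x 0 with hx | hx
  · rcases le_or_gt y 0 with hy | hy
    · nlinarith
    · nlinarith
  rcases le_or_gt y 0 with hy | hy
  · nlinarith
  have hxy : 0 < x + y := by linarith
  -- The other sign patterns follow from monotonicity alone. Here `j` is optimal at `m`; passing
  -- from `m` to `x / (x + y)` shifts weight to one coordinate, in which either `i` or `k` is no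
  -- better than `j`.
  obtain ⟨m, hm, hjm⟩ := exists_isLowest_index H h0 h1 hjN
  have e₁ := hjm.2 i (hij.le.trans hjN)
  have e₂ := hjm.2 k hk
  rcases le_total (m * (x + y)) x with h | h
  · have := mul_le_mul_of_nonneg_left e₁ hxy.le
    nlinarith [mul_nonneg (sub_nonneg.2 h) (sub_nonneg.2 a₁),
      mul_nonneg (sub_nonneg.2 h) (sub_nonneg.2 a₂)]
  · have := mul_le_mul_of_nonneg_left e₂ hxy.le
    nlinarith [mul_nonneg (sub_nonneg.2 h) (sub_nonneg.2 b₁),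
      mul_nonneg (sub_nonneg.2 h) (sub_nonneg.2 b₂)]
end hull

/-! ### Angle sums along polygonal paths -/

/-- Modulo 2π the only ambiguity in [-π, π] is between the two ends, and the slit plane excludes the
argument π. -/
lemma mem_slitPlane_of_arg_toReal {z : ℂ} (hz : z ∈ Complex.slitPlane) {θ : ℝ}
    (h : (Complex.arg z : Real.Angle) = θ) (h1 : -Real.pi ≤ θ) (h2 : θ ≤ Real.pi) :
    Complex.arg z = θ := by
  have hpi : Complex.arg z ≠ Real.pi := (Complex.mem_slitPlane_iff_arg.1 hz).1
  have hz' : (Complex.arg z : Real.Angle).toReal = Complex.arg z :=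
    Real.Angle.toReal_coe_eq_self_iff.2 ⟨Complex.neg_pi_lt_arg z, Complex.arg_le_pi z⟩
  rcases h1.eq_or_lt with rfl | h1
  · rw [h, Real.Angle.coe_neg, Real.Angle.neg_coe_pi, Real.Angle.toReal_pi] at hz'
    exact absurd hz'.symm hpi
  · rw [h, Real.Angle.toReal_coe_eq_self_iff.2 ⟨h1, h2⟩] at hz'
    exact hz'.symm

lemma arg_div_of_re_nonneg {z w : ℂ} (hz : z ≠ 0) (hw : w ≠ 0) (hzr : 0 ≤ z.re) (hwr : 0 ≤ w.re)
    (h : w / z ∈ Complex.slitPlane) : Complex.arg (w / z) = Complex.arg w - Complex.arg z := by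
  have h1 := abs_le.1 (Complex.abs_arg_le_pi_div_two_iff.2 hzr)
  have h2 := abs_le.1 (Complex.abs_arg_le_pi_div_two_iff.2 hwr)
  refine mem_slitPlane_of_arg_toReal h ?_ (by linarith) (by linarith)
  rw [Complex.arg_div_coe_angle hw hz, Real.Angle.coe_sub]

lemma arg_le_arg_of_cross {z w : ℂ} (hz : z ≠ 0) (hw : w ≠ 0) (hzr : 0 ≤ z.re) (hwr : 0 ≤ w.re)
    (h : z.re * w.im - z.im * w.re ≤ 0) (h' : z.re = 0 → 0 ≤ z.im) :
    Complex.arg w ≤ Complex.arg z := by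
  have h1 := abs_le.1 (Complex.abs_arg_le_pi_div_two_iff.2 hzr)
  have h2 := abs_le.1 (Complex.abs_arg_le_pi_div_two_iff.2 hwr)
  have hz0 := norm_pos_iff.2 hz
  have hw0 := norm_pos_iff.2 hw
  by_contra! hc
  have hsin : ‖z‖ * ‖w‖ * Real.sin (Complex.arg w - Complex.arg z) =
      z.re * w.im - z.im * w.re := by
    rw [Real.sin_sub, ← Complex.norm_mul_cos_arg z, ← Complex.norm_mul_cos_arg w,
      ← Complex.norm_mul_sin_arg z, ← Complex.norm_mul_sin_arg w]
    ring
  rcases (show Complex.arg w - Complex.arg z ≤ Real.pi by linarith).eq_or_lt with he | hlt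
  · have hza : Complex.arg z = -(Real.pi / 2) := by linarith
    obtain ⟨e1, e2⟩ := Complex.arg_eq_neg_pi_div_two_iff.1 hza
    linarith [h' e1]
  · have := Real.sin_pos_of_pos_of_lt_pi (sub_pos.2 hc) hlt
    have := mul_pos (mul_pos hz0 hw0) this
    linarith

/-- Otherwise `w` would be a negative multiple of `z`, and both quotients would be negative reals.
-/
lemma cross_ne_zero_of_re {z w : ℂ} (hz : z ≠ 0) (hzr : 0 ≤ z.re) (hwr : w.re < 0)
    (h : w / z ∈ Complex.slitPlane ∨ z / w ∈ Complex.slitPlane) :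
    z.re * w.im - z.im * w.re ≠ 0 := by
  intro hc
  have hzr' : 0 < z.re := by
    rcases hzr.eq_or_lt with h0 | h0
    · exfalso
      apply hz
      rw [← h0] at hc
      have : z.im * w.re = 0 := by linarith
      exact Complex.ext h0.symm ((mul_eq_zero.1 this).resolve_right hwr.ne)
    · exact h0
  have hdot : z.re * w.re + z.im * w.im < 0 := by
    have e : z.re * (z.re * w.re + z.im * w.im) = w.re * (z.re ^ 2 + z.im ^ 2) := by
      linear_combination z.im * hc
    have : w.re * (z.re ^ 2 + z.im ^ 2) < 0 := by
      have : 0 < z.re ^ 2 + z.im ^ 2 := by positivity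
      nlinarith
    by_contra! h2
    nlinarith [mul_nonneg hzr h2]
  have hzn : 0 < Complex.normSq z := Complex.normSq_pos.2 hz
  have hwn : 0 < Complex.normSq w := Complex.normSq_pos.2 (fun h => by simp [h] at hwr)
  rcases h with h | h <;> rcases Complex.mem_slitPlane_iff.1 h with h | h
  · rw [Complex.div_re, ← add_div] at h
    have := (div_pos_iff_of_pos_right hzn).1 h
    linarith
  · rw [Complex.div_im, ← sub_div] at h
    apply h
    rw [div_eq_zero_iff]; left; linarith
  · rw [Complex.div_re, ← add_div] at h
    have := (div_pos_iff_of_pos_right hwn).1 h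
    linarith
  · rw [Complex.div_im, ← sub_div] at h
    apply h
    rw [div_eq_zero_iff]; left; linarith

lemma arg_div_pos {z w : ℂ} (hz : z ≠ 0) (h : 0 < z.re * w.im - z.im * w.re) :
    0 < Complex.arg (w / z) := by
  have hzn : 0 < Complex.normSq z := Complex.normSq_pos.2 hz
  have him : 0 < (w / z).im := by
    rw [Complex.div_im, ← sub_div]; apply div_pos _ hzn; linarith
  refine lt_of_le_of_ne (Complex.arg_nonneg_iff.2 him.le) fun h0 => ?_
  exact him.ne' (Complex.arg_eq_zero_iff.1 h0.symm).2

lemma arg_div_neg {z w : ℂ} (hz : z ≠ 0) (h : z.re * w.im - z.im * w.re < 0) :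
    Complex.arg (w / z) < 0 := by
  have hzn : 0 < Complex.normSq z := Complex.normSq_pos.2 hz
  rw [Complex.arg_neg_iff, Complex.div_im, ← sub_div]
  apply div_neg_of_neg_of_pos _ hzn; linarith

/-- Around a triangle that contains the origin, the path over the corner `B` in the left half plane
and the paths in the right half plane have different angle sums. -/
lemma arg_add_arg_ne {A B C : ℂ} {α β κ : ℝ} (hA : A ≠ 0) (hC : C ≠ 0) (hAr : 0 ≤ A.re)
    (hCr : 0 ≤ C.re) (hBr : B.re < 0) (hα : 0 ≤ α) (hβ : 0 ≤ β) (hκ : 0 ≤ κ)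
    (hsum : α + β + κ = 1) (h0 : (α : ℂ) * A + β * B + κ * C = 0)
    (hBA : B / A ∈ Complex.slitPlane) (hCB : C / B ∈ Complex.slitPlane) :
    Complex.arg (B / A) + Complex.arg (C / B) ≠ Complex.arg C - Complex.arg A := by
  have hB : B ≠ 0 := fun h => by simp [h] at hBr
  have hre : α * A.re + β * B.re + κ * C.re = 0 := by simpa using congrArg Complex.re h0
  have him : α * A.im + β * B.im + κ * C.im = 0 := by simpa using congrArg Complex.im h0
  have e₁ : α * (A.re * B.im - A.im * B.re) = κ * (B.re * C.im - B.im * C.re) := by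
    linear_combination B.im * hre - B.re * him
  have e₂ : κ * (C.re * A.im - C.im * A.re) = β * (A.re * B.im - A.im * B.re) := by
    linear_combination A.im * hre - A.re * him
  have n₁ := cross_ne_zero_of_re hA hAr hBr (Or.inl hBA)
  have n₂ := cross_ne_zero_of_re hC hCr hBr (Or.inr hCB)
  have hκ' : 0 < κ := by
    rcases hκ.eq_or_lt with h | h
    · exfalso
      rw [← h, zero_mul] at e₁ e₂
      have hα0 := (mul_eq_zero.1 e₁).resolve_right n₁
      have hβ0 := (mul_eq_zero.1 e₂.symm).resolve_right n₁
      rw [hα0, hβ0, ← h] at hsum; norm_num at hsum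
    · exact h
  -- The turns from `A` to `B` and from `B` to `C` have the same strict orientation, while the
  -- direct turn from `A` to `C` within the right half plane is zero or of the opposite orientation.
  rcases lt_or_gt_of_ne n₁ with h | h
  · have hBC : B.re * C.im - B.im * C.re < 0 := by
      have : B.re * C.im - B.im * C.re ≤ 0 := by
        by_contra! hc
        nlinarith [mul_pos hκ' hc, mul_nonneg hα (neg_nonneg.2 h.le)]
      exact lt_of_le_of_ne this fun h => n₂ (by linarith)
    have hCA : C.re * A.im - C.im * A.re ≤ 0 := by
      by_contra! hc
      nlinarith [mul_pos hκ' hc, mul_nonneg hβ (neg_nonneg.2 h.le)]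
    have := arg_le_arg_of_cross hC hA hCr hAr hCA (fun h0 => by
      rw [h0] at hBC
      by_contra! hc
      nlinarith)
    have := arg_div_neg hA h
    have := arg_div_neg hB hBC
    intro; linarith
  · have hBC : 0 < B.re * C.im - B.im * C.re := by
      have : 0 ≤ B.re * C.im - B.im * C.re := by
        by_contra! hc
        nlinarith [mul_pos hκ' (neg_pos.2 hc), mul_nonneg hα h.le]
      exact lt_of_le_of_ne this fun h => n₂ (by linarith)
    have hCA : 0 ≤ C.re * A.im - C.im * A.re := by
      by_contra! hc
      nlinarith [mul_pos hκ' (neg_pos.2 hc), mul_nonneg hβ h.le]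
    have := arg_le_arg_of_cross hA hC hAr hCr (by linarith) (fun h0 => by
      rw [h0] at h
      by_contra! hc
      nlinarith)
    have := arg_div_pos hA h
    have := arg_div_pos hB hBC
    intro; linarith

/-- The plane as the complex numbers. -/
noncomputable def toC : Pt ≃ₗᵢ[ℝ] ℂ := Complex.orthonormalBasisOneI.repr.symm

/-- The oriented angle, between `-π` and `π`, under which `x` sees `q` from `p`. -/
noncomputable def ang (x p q : Pt) : ℝ := Complex.arg (toC (q - x) / toC (p - x))

lemma toC_sub_ne_zero {p x : Pt} (h : x ≠ p) : toC (p - x) ≠ 0 := by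
  simpa [sub_eq_zero] using h.symm

/-- The branch cut of `Complex.arg` is met only when `x` lies between `p` and `q`; this makes angle
sums continuous off the path. -/
lemma div_mem_slitPlane {x p q : Pt} (h : x ∉ segment ℝ p q) :
    toC (q - x) / toC (p - x) ∈ Complex.slitPlane := by
  have hp : toC (p - x) ≠ 0 := toC_sub_ne_zero fun e => h (e ▸ left_mem_segment ℝ _ _)
  rw [Complex.mem_slitPlane_iff_not_le_zero]
  intro hle
  obtain ⟨hre, him⟩ := Complex.le_def.1 hle
  simp only [Complex.zero_re, Complex.zero_im] at hre him
  set r := (toC (q - x) / toC (p - x)).re with hr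
  have e : toC (q - x) / toC (p - x) = (r : ℂ) := Complex.ext (by simp [hr]) (him.trans (Complex.ofReal_im r).symm)
  rw [div_eq_iff hp] at e
  have e' : q - x = r • (p - x) := by
    apply toC.injective
    rw [e, map_smul, Complex.real_smul]
  apply h
  refine ⟨-r / (1 - r), 1 / (1 - r), div_nonneg (by linarith) (by linarith),
    div_nonneg zero_le_one (by linarith), ?_, ?_⟩
  · have : (1 - r) ≠ 0 := by linarith
    field_simp; ring
  · have : (1 - r) ≠ 0 := by linarith
    have hq : q = x + r • (p - x) := by rw [← e']; abel
    rw [hq, div_eq_inv_mul, div_eq_inv_mul, mul_smul, mul_smul, ← smul_add, inv_smul_eq_iff₀ this]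
    module

lemma continuousAt_ang {x p q : Pt} (h : x ∉ segment ℝ p q) :
    ContinuousAt (fun y => ang y p q) x := by
  have hp : toC (p - x) ≠ 0 := toC_sub_ne_zero fun e => h (e ▸ left_mem_segment ℝ _ _)
  refine ContinuousAt.comp (f := fun y => toC (q - y) / toC (p - y))
    (Complex.continuousAt_arg (div_mem_slitPlane h)) ?_
  refine ContinuousAt.div ?_ ?_ hp
  · exact (toC.continuous.comp (by fun_prop)).continuousAt
  · exact (toC.continuous.comp (by fun_prop)).continuousAt

@[simp] lemma pathCarrier_singleton (p : Pt) : pathCarrier [p] = {p} := by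
  ext x; simp [pathCarrier]

lemma pathCarrier_cons_cons (p q : Pt) (l : List Pt) :
    pathCarrier (p :: q :: l) = segment ℝ p q ∪ pathCarrier (q :: l) := by
  ext x
  simp only [pathCarrier, Set.mem_ofPred_eq, List.tail_cons, List.zip_cons_cons, List.mem_cons,
    exists_eq_or_imp, Set.mem_union]
  have := left_mem_segment ℝ p q
  constructor
  · rintro ((rfl | h) | (h | h))
    · exact Or.inl this
    · exact Or.inr (Or.inl h)
    · exact Or.inl h
    · exact Or.inr (Or.inr h)
  · rintro (h | (h | h))
    · exact Or.inr (Or.inl h)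
    · exact Or.inl (Or.inr h)
    · exact Or.inr (Or.inr h)

lemma mem_pathCarrier {l : List Pt} {p : Pt} (h : p ∈ l) : p ∈ pathCarrier l := Or.inl h

lemma continuousAt_angSum {l : List Pt} {x : Pt} (h : x ∉ pathCarrier l) :
    ContinuousAt (fun y => pairSum (ang y) l) x := by
  induction l with
  | nil => exact continuousAt_const
  | cons p l ih =>
    cases l with
    | nil => exact continuousAt_const
    | cons q l =>
      rw [pathCarrier_cons_cons, Set.mem_union, not_or] at h
      exact (continuousAt_ang h.1).add (ih h.2)

/-- Modulo 2π the sum telescopes, so angle sums of two paths with common ends differ by a multiple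
of 2π. -/
lemma coe_angSum {l : List Pt} {x p q : Pt} (hp : l.head? = some p) (hq : l.getLast? = some q)
    (h : x ∉ l) : ((pairSum (ang x) l : ℝ) : Real.Angle) =
      (Complex.arg (toC (q - x)) : Real.Angle) - Complex.arg (toC (p - x)) := by
  induction l generalizing p with
  | nil => simp at hp
  | cons z l ih =>
    obtain rfl : z = p := by simpa using hp
    cases l with
    | nil =>
      obtain rfl : z = q := by simpa using hq
      simp
    | cons w l =>
      simp only [List.mem_cons, not_or] at h
      rw [pairSum_cons_cons, Real.Angle.coe_add, ih (p := w) rfl (by simpa using hq)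
        (by simpa using h.2), ang, Complex.arg_div_coe_angle (toC_sub_ne_zero h.2.1)
        (toC_sub_ne_zero h.1)]
      abel

/-- Multiplication by `u` turns a half plane bounded by a line through `x` into the right half
plane. There the arguments lie in [-π/2, π/2], no branch jump occurs, and the sum telescopes
exactly. -/
lemma angSum_of_re_nonneg {l : List Pt} {x p q : Pt} {u : ℂ} (hu : u ≠ 0)
    (hp : l.head? = some p) (hq : l.getLast? = some q) (h : x ∉ pathCarrier l)
    (hl : ∀ v ∈ l, 0 ≤ (toC (v - x) * u).re) :
    pairSum (ang x) l = Complex.arg (toC (q - x) * u) - Complex.arg (toC (p - x) * u) := by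
  induction l generalizing p with
  | nil => simp at hp
  | cons z l ih =>
    obtain rfl : z = p := by simpa using hp
    cases l with
    | nil =>
      obtain rfl : z = q := by simpa using hq
      simp
    | cons w l =>
      have hz : x ≠ z := fun e => h (e ▸ mem_pathCarrier (by simp))
      have hw : x ≠ w := fun e => h (e ▸ mem_pathCarrier (by simp))
      rw [pathCarrier_cons_cons, Set.mem_union, not_or] at h
      rw [pairSum_cons_cons, ih (p := w) rfl (by simpa using hq) h.2
        fun v hv => hl v (List.mem_cons_of_mem _ hv)]
      have e : toC (w - x) / toC (z - x) = (toC (w - x) * u) / (toC (z - x) * u) := by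
        rw [mul_div_mul_right _ _ hu]
      have hs := div_mem_slitPlane h.1
      rw [e] at hs
      rw [ang, e, arg_div_of_re_nonneg (mul_ne_zero (toC_sub_ne_zero hz) hu)
        (mul_ne_zero (toC_sub_ne_zero hw) hu) (hl z (by simp)) (hl w (by simp)) hs]
      ring

lemma exists_linear_eq_re (f : Pt →ₗ[ℝ] ℝ) : ∃ u : ℂ, ∀ p, f p = (toC p * u).re := by
  refine ⟨⟨f (toC.symm 1), -f (toC.symm Complex.I)⟩, fun p => ?_⟩
  have hp : p = (toC p).re • toC.symm 1 + (toC p).im • toC.symm Complex.I := by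
    apply toC.injective
    rw [map_add, map_smul, map_smul, toC.apply_symm_apply, toC.apply_symm_apply]
    simpa [mul_comm] using (Complex.re_add_im (toC p)).symm
  conv_lhs => rw [hp]
  simp [Complex.mul_re]

/-- The difference of the angle sums of two paths with the same endpoints is constant on connected
sets that avoid the paths. -/
lemma angSum_sub_eq {l l' : List Pt} {p q : Pt} (hp : l.head? = some p) (hq : l.getLast? = some q)
    (hp' : l'.head? = some p) (hq' : l'.getLast? = some q) {K : Set Pt} (hK : IsPreconnected K)
    (hl : ∀ x ∈ K, x ∉ pathCarrier l) (hl' : ∀ x ∈ K, x ∉ pathCarrier l') {x y : Pt} (hx : x ∈ K)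
    (hy : y ∈ K) (h : pairSum (ang x) l = pairSum (ang x) l') :
    pairSum (ang y) l = pairSum (ang y) l' := by
  by_contra hne
  set D : Pt → ℝ := fun z => pairSum (ang z) l - pairSum (ang z) l' with hD
  have hc : ContinuousOn D K := fun z hz =>
    ((continuousAt_angSum (hl z hz)).sub (continuousAt_angSum (hl' z hz))).continuousWithinAt
  have hint : ∀ z ∈ K, ∃ n : ℤ, n • (2 * Real.pi) = D z := fun z hz => by
    rw [← Real.Angle.coe_eq_zero_iff, hD, Real.Angle.coe_sub,
      coe_angSum hp hq fun h => hl z hz (mem_pathCarrier h),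
      coe_angSum hp' hq' fun h => hl' z hz (mem_pathCarrier h), sub_self]
  have hoc := (hK.image D hc).ordConnected
  have hDx : D x = 0 := sub_eq_zero.2 h
  obtain ⟨n, hn⟩ := hint y hy
  have hn0 : n ≠ 0 := by
    rintro rfl
    exact hne (sub_eq_zero.1 (by simpa using hn.symm))
  have hpi := Real.pi_pos
  -- The image of `K` is an interval containing 0. A nonzero multiple of 2π in it would bring along
  -- π or -π, an odd multiple of π.
  have no : ∀ z ∈ K, ∀ m : ℤ, Odd m → D z ≠ m * Real.pi := by
    intro z hz m hm he
    obtain ⟨k, hk⟩ := hint z hz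
    rw [he, zsmul_eq_mul, ← mul_assoc] at hk
    have := mul_right_cancel₀ hpi.ne' hk
    have : k * 2 = m := by exact_mod_cast this
    rw [← this] at hm
    exact (Int.not_odd_iff_even.2 ⟨k, by ring⟩) hm
  rw [zsmul_eq_mul] at hn
  rcases lt_or_gt_of_ne hn0 with h0 | h0
  · have h1 : (n : ℝ) ≤ -1 := by exact_mod_cast Int.le_sub_one_of_lt h0
    obtain ⟨z, hz, hz'⟩ := hoc.out ⟨y, hy, rfl⟩ ⟨x, hx, rfl⟩
      (show -Real.pi ∈ Set.Icc (D y) (D x) from ⟨by nlinarith, by linarith⟩)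
    exact no z hz (-1) (by decide) (by simpa using hz')
  · have h1 : (1 : ℝ) ≤ n := by exact_mod_cast h0
    obtain ⟨z, hz, hz'⟩ := hoc.out ⟨x, hx, rfl⟩ ⟨y, hy, rfl⟩
      (show Real.pi ∈ Set.Icc (D x) (D y) from ⟨by linarith, by nlinarith⟩)
    exact no z hz 1 (by decide) (by simpa using hz')

/-! ### Simple polygons -/

lemma segment_subset_halfOpenEdge (p q : Pt) : segment ℝ p q ⊆ halfOpenEdge (p, q) ∪ {q} := by
  rw [segment_eq_image_lineMap]
  rintro _ ⟨r, hr, rfl⟩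
  rcases hr.2.eq_or_lt with rfl | h
  · right; simp
  · exact Or.inl ⟨r, ⟨hr.1, h⟩, rfl⟩

lemma left_mem_halfOpenEdge (p q : Pt) : p ∈ halfOpenEdge (p, q) := ⟨0, by simp⟩

lemma openSegment_subset_halfOpenEdge (p q : Pt) : openSegment ℝ p q ⊆ halfOpenEdge (p, q) := by
  rw [openSegment_eq_image_lineMap]
  exact Set.image_mono Set.Ioo_subset_Ico_self

lemma cycEdges_three (a b c : Pt) (l : List Pt) :
    cycEdges (a :: b :: c :: l) = (a, b) :: (b, c) :: (c :: l).zip (l ++ [a]) := by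
  simp [cycEdges]

lemma pathCarrier_append_singleton (c : Pt) (l : List Pt) (a : Pt) :
    pathCarrier (c :: (l ++ [a])) = {x | ∃ e ∈ (c :: l).zip (l ++ [a]), x ∈ segment ℝ e.1 e.2} := by
  induction l generalizing c with
  | nil =>
    ext x
    simp only [List.nil_append, pathCarrier_cons_cons, pathCarrier_singleton, List.zip_cons_cons,
      List.zip_nil_left, List.mem_singleton, exists_eq_left, Set.union_singleton,
      Set.mem_insert_iff, Set.mem_ofPred_eq, or_iff_right_iff_imp]
    rintro rfl
    exact right_mem_segment ℝ _ _
  | cons d l ih =>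
    rw [List.cons_append, pathCarrier_cons_cons, ih]
    ext x
    simp

/-- The part of a closed polygon `a :: b :: c :: l` that leads from `c` back to `a`. -/
lemma boundary_three (a b c : Pt) (l : List Pt) : boundary (a :: b :: c :: l) =
    segment ℝ a b ∪ segment ℝ b c ∪ pathCarrier (c :: (l ++ [a])) := by
  ext x
  rw [pathCarrier_append_singleton]
  simp only [boundary, cycEdges_three, List.mem_cons (a := ((_, _) : Pt × Pt)), or_assoc,
    exists_eq_or_imp, Set.mem_ofPred_eq, Set.mem_union]

lemma IsSimplePolygon.congr {l l' : List Pt} (h : l.IsRotated l') (hl : IsSimplePolygon l) :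
    IsSimplePolygon l' :=
  ⟨h.perm.length_eq ▸ hl.1, ((cycEdges_perm h).pairwise_iff fun {_ _} h => h.symm).1 hl.2⟩

lemma map_fst_cycEdges (l : List Pt) : (cycEdges l).map Prod.fst = l :=
  List.map_fst_zip (by simp)

lemma IsSimplePolygon.nodup {l : List Pt} (hl : IsSimplePolygon l) : l.Nodup := by
  rw [← map_fst_cycEdges l, List.Nodup, List.pairwise_map]
  refine hl.2.imp fun {e f} h he => ?_
  exact Set.disjoint_left.1 h (left_mem_halfOpenEdge e.1 e.2) (he ▸ left_mem_halfOpenEdge f.1 f.2)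

section three
variable {a b c : Pt} {l : List Pt} (h : IsSimplePolygon (a :: b :: c :: l))
include h

lemma IsSimplePolygon.disjoint_ab_bc : Disjoint (halfOpenEdge (a, b)) (halfOpenEdge (b, c)) := by
  have := h.2
  rw [cycEdges_three, List.pairwise_cons] at this
  exact this.1 _ (by simp)

lemma IsSimplePolygon.disjoint_ab {e : Pt × Pt} (he : e ∈ (c :: l).zip (l ++ [a])) :
    Disjoint (halfOpenEdge (a, b)) (halfOpenEdge e) := by
  have := h.2
  rw [cycEdges_three, List.pairwise_cons] at this
  exact this.1 _ (by simp [he])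

lemma IsSimplePolygon.disjoint_bc {e : Pt × Pt} (he : e ∈ (c :: l).zip (l ++ [a])) :
    Disjoint (halfOpenEdge (b, c)) (halfOpenEdge e) := by
  have := h.2
  rw [cycEdges_three, List.pairwise_cons, List.pairwise_cons] at this
  exact this.2.1 _ he

lemma IsSimplePolygon.ne_ac : a ≠ c := by
  have := h.nodup
  simp at this
  tauto

omit h in
/-- Every vertex on the path from `c` to `a`, apart from `a`, starts an edge. -/
lemma exists_edge_of_mem {c : Pt} {l : List Pt} {a v : Pt} (hv : v ∈ c :: l) :
    ∃ e ∈ (c :: l).zip (l ++ [a]), e.1 = v := by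
  have : v ∈ ((c :: l).zip (l ++ [a])).map Prod.fst := by
    rwa [List.map_fst_zip (by simp)]
  simpa using this

omit h in
lemma edge_snd_mem {c : Pt} {l : List Pt} {a : Pt} {e : Pt × Pt}
    (he : e ∈ (c :: l).zip (l ++ [a])) : e.2 ∈ l ∨ e.2 = a := by
  have := (List.of_mem_zip he).2
  simpa using this

/-- A common point other than `c` lies on the half-open edge `ab` or `bc`, and one other than `a`
lies on a half-open edge of the rest; these are disjoint. -/
lemma IsSimplePolygon.edge_inter {e : Pt × Pt} (he : e ∈ (c :: l).zip (l ++ [a])) {x : Pt}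
    (hx : x ∈ segment ℝ e.1 e.2) (hx' : x ∈ segment ℝ a b ∪ segment ℝ b c) : x = a ∨ x = c := by
  by_cases hxa : x = a
  · exact Or.inl hxa
  right
  by_contra hxc
  have h1 : x ∈ halfOpenEdge (a, b) ∨ x ∈ halfOpenEdge (b, c) := by
    rcases hx' with hx' | hx'
    · rcases segment_subset_halfOpenEdge _ _ hx' with h | rfl
      · exact Or.inl h
      · exact Or.inr (left_mem_halfOpenEdge _ _)
    · rcases segment_subset_halfOpenEdge _ _ hx' with h | h
      · exact Or.inr h
      · exact absurd h hxc
  have h2 : ∃ f ∈ (c :: l).zip (l ++ [a]), x ∈ halfOpenEdge f := by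
    rcases segment_subset_halfOpenEdge _ _ hx with h' | rfl
    · exact ⟨e, he, h'⟩
    · rcases edge_snd_mem he with h' | h'
      · obtain ⟨f, hf, hf'⟩ := exists_edge_of_mem (a := a) (List.mem_cons_of_mem c h')
        exact ⟨f, hf, hf' ▸ left_mem_halfOpenEdge f.1 f.2⟩
      · exact absurd h' hxa
  obtain ⟨f, hf, hf'⟩ := h2
  rcases h1 with h1 | h1
  · exact Set.disjoint_left.1 (h.disjoint_ab hf) h1 hf'
  · exact Set.disjoint_left.1 (h.disjoint_bc hf) h1 hf'

/-- Otherwise `c` would lie on `ab` or `a` on `bc`, where half-open edges would meet. -/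
lemma IsSimplePolygon.not_collinear (hb : b ∉ segment ℝ a c) : ¬ Collinear ℝ {a, b, c} := by
  intro hcol
  have hnd := h.nodup
  simp only [List.nodup_cons, List.mem_cons, not_or] at hnd
  obtain ⟨f, hf, hf'⟩ := exists_edge_of_mem (a := a) (List.mem_cons_self (a := c) (l := l))
  have hcf : c ∈ halfOpenEdge f := hf' ▸ left_mem_halfOpenEdge f.1 f.2
  rcases hcol.wbtw_or_wbtw_or_wbtw with h' | h' | h'
  · exact hb (mem_segment_iff_wbtw.2 h')
  · have hc : c ∈ segment ℝ a b := mem_segment_iff_wbtw.2 h'.symm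
    rcases segment_subset_halfOpenEdge _ _ hc with h2 | h2
    · exact Set.disjoint_left.1 (h.disjoint_ab hf) h2 hcf
    · exact hnd.2.1.1 (Eq.symm h2)
  · have hc : a ∈ segment ℝ b c := mem_segment_iff_wbtw.2 h'.symm
    rcases segment_subset_halfOpenEdge _ _ hc with h2 | h2
    · exact Set.disjoint_left.1 h.disjoint_ab_bc (left_mem_halfOpenEdge _ _) h2
    · exact hnd.1.2.1 h2

end three

lemma isPreconnected_segment_diff {p q : Pt} {Z : Set Pt} (h : Disjoint (openSegment ℝ p q) Z) :
    IsPreconnected (segment ℝ p q \ Z) := by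
  refine (convex_openSegment p q).isPreconnected.subset_closure
    (fun x hx => ⟨openSegment_subset_segment ℝ p q hx, Set.disjoint_left.1 h hx⟩) ?_
  rw [closure_openSegment]
  exact Set.sdiff_subset

/-- Consecutive edges are glued at the vertices of `l`, which survive the removal of `Z`. The ends
of the path may be lost. -/
lemma isPreconnected_pathCarrier_diff {Z : Set Pt} (c : Pt) (l : List Pt) (a : Pt)
    (h : ∀ e ∈ (c :: l).zip (l ++ [a]), Disjoint (openSegment ℝ e.1 e.2) Z)
    (hl : ∀ v ∈ l, v ∉ Z) (ha : a ∈ Z) : IsPreconnected (pathCarrier (c :: (l ++ [a])) \ Z) := by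
  induction l generalizing c with
  | nil =>
    have : pathCarrier (c :: ([] ++ [a])) \ Z = segment ℝ c a \ Z := by
      rw [List.nil_append, pathCarrier_cons_cons, pathCarrier_singleton]
      ext x
      simp only [Set.mem_sdiff, Set.mem_union, Set.mem_singleton_iff]
      constructor
      · rintro ⟨h | rfl, h'⟩
        · exact ⟨h, h'⟩
        · exact absurd ha h'
      · rintro ⟨h, h'⟩
        exact ⟨Or.inl h, h'⟩
    rw [this]
    exact isPreconnected_segment_diff (h (c, a) (by simp))
  | cons d l ih =>
    rw [List.cons_append, pathCarrier_cons_cons, Set.union_sdiff_distrib]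
    refine IsPreconnected.union d ⟨right_mem_segment ℝ _ _, hl d (by simp)⟩
      ⟨mem_pathCarrier (by simp), hl d (by simp)⟩
      (isPreconnected_segment_diff (h (c, d) (by simp))) (ih d ?_ ?_)
    · intro e he
      exact h e (by simpa using Or.inr he)
    · exact fun v hv => hl v (List.mem_cons_of_mem _ hv)

/-- The edges of the path from `c` back to `a` contain `a` and `c` at most as endpoints. -/
lemma IsSimplePolygon.disjoint_openSegment {a b c : Pt} {l : List Pt}
    (h : IsSimplePolygon (a :: b :: c :: l)) {e : Pt × Pt} (he : e ∈ (c :: l).zip (l ++ [a])) :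
    Disjoint (openSegment ℝ e.1 e.2) {a, c} := by
  have hnd := h.nodup
  simp only [List.nodup_cons, List.mem_cons, not_or] at hnd
  rw [Set.disjoint_left]
  intro x hx hx'
  have hxe := openSegment_subset_halfOpenEdge _ _ hx
  rcases hx' with rfl | hx'
  · exact Set.disjoint_left.1 (h.disjoint_ab he) (left_mem_halfOpenEdge _ _) hxe
  · rw [Set.mem_singleton_iff] at hx'
    subst hx'
    have hp := h.2
    rw [cycEdges_three, List.pairwise_cons, List.pairwise_cons] at hp
    have hp := hp.2.2
    cases l with
    | nil =>
      simp only [List.nil_append, List.zip_cons_cons, List.zip_nil_left, List.mem_singleton] at he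
      subst he
      exact h.ne_ac (left_mem_openSegment_iff.1 hx).symm
    | cons d l =>
      simp only [List.cons_append, List.zip_cons_cons, List.mem_cons] at he
      rw [List.cons_append, List.zip_cons_cons, List.pairwise_cons] at hp
      rcases he with rfl | he
      · exact hnd.2.2.1 (by simpa using Or.inl (left_mem_openSegment_iff.1 hx))
      · exact Set.disjoint_left.1 (hp.1 e (by simpa using he)) (left_mem_halfOpenEdge _ _) hxe

/-- The path from `c` back to `a`, without its endpoints, is connected. -/
lemma IsSimplePolygon.isPreconnected_rest {a b c : Pt} {l : List Pt}
    (h : IsSimplePolygon (a :: b :: c :: l)) :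
    IsPreconnected (pathCarrier (c :: (l ++ [a])) \ {a, c}) := by
  have hnd := h.nodup
  simp only [List.nodup_cons, List.mem_cons, not_or] at hnd
  refine isPreconnected_pathCarrier_diff c l a (fun e he => h.disjoint_openSegment he) ?_ (by simp)
  rintro v hv (rfl | hv')
  · exact hnd.1.2.2 hv
  · rw [Set.mem_singleton_iff] at hv'
    exact hnd.2.2.1 (hv' ▸ hv)

/-! ### Barycentric coordinates of a triangle -/

lemma exists_barycentric {a b c : Pt} (h : ¬ Collinear ℝ {a, b, c}) :
    ∃ s m t : Pt →ᵃ[ℝ] ℝ, (s a = 1 ∧ m a = 0 ∧ t a = 0) ∧ (s b = 0 ∧ m b = 1 ∧ t b = 0) ∧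
      (s c = 0 ∧ m c = 0 ∧ t c = 1) ∧ (∀ x, s x + m x + t x = 1) ∧
      (∀ x, x = s x • a + m x • b + t x • c) ∧
      ∀ x, x ∈ triangle a b c ↔ 0 ≤ s x ∧ 0 ≤ m x ∧ 0 ≤ t x := by
  have hi := affineIndependent_iff_not_collinear_set.2 h
  have ht : affineSpan ℝ (Set.range ![a, b, c]) = ⊤ := by
    rw [hi.affineSpan_eq_top_iff_card_eq_finrank_add_one]
    simp
  let B : AffineBasis (Fin 3) ℝ Pt := ⟨![a, b, c], hi, ht⟩
  have hB : ∀ i, B i = ![a, b, c] i := fun i => rfl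
  have e0 : B 0 = a := rfl
  have e1 : B 1 = b := rfl
  have e2 : B 2 = c := rfl
  refine ⟨B.coord 0, B.coord 1, B.coord 2, ?_, ?_, ?_, ?_, ?_, ?_⟩
  · rw [← e0]; simp [B.coord_apply]
  · rw [← e1]; simp [B.coord_apply]
  · rw [← e2]; simp [B.coord_apply]
  · intro x
    have := B.sum_coord_apply_eq_one x
    rwa [Fin.sum_univ_three] at this
  · intro x
    have := B.linear_combination_coord_eq_self x
    rw [Fin.sum_univ_three, e0, e1, e2] at this
    exact this.symm
  · intro x
    have hr : Set.range B = {a, b, c} := by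
      ext y
      simp [Set.mem_range, Fin.exists_fin_succ, hB, eq_comm]
    have := B.convexHull_eq_nonneg_coord
    rw [triangle, ← hr, this]
    simp [Fin.forall_fin_succ]

lemma affine_segment {f : Pt →ᵃ[ℝ] ℝ} {p q : Pt} {u v : ℝ} (h : u + v = 1) :
    f (u • p + v • q) = u * f p + v * f q := by
  have := Convex.combo_affine_apply (f := f) (x := p) (y := q) h
  simpa using this

lemma segment_subset_triangle {a b c p q : Pt} (hp : p ∈ triangle a b c) (hq : q ∈ triangle a b c) :
    segment ℝ p q ⊆ triangle a b c :=
  (convex_convexHull ℝ _).segment_subset hp hq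

lemma left_mem_triangle (a b c : Pt) : a ∈ triangle a b c := subset_convexHull ℝ _ (by simp)
lemma mid_mem_triangle (a b c : Pt) : b ∈ triangle a b c := subset_convexHull ℝ _ (by simp)
lemma right_mem_triangle (a b c : Pt) : c ∈ triangle a b c := subset_convexHull ℝ _ (by simp)

/-- The coordinates `s`, `m`, `t` are those of the proper triangle `abc`. -/
structure IsBarycentric (a b c : Pt) (s m t : Pt →ᵃ[ℝ] ℝ) : Prop where
  sa : s a = 1
  ma : m a = 0
  ta : t a = 0
  sb : s b = 0
  mb : m b = 1
  tb : t b = 0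
  sc : s c = 0
  mc : m c = 0
  tc : t c = 1
  sum : ∀ x, s x + m x + t x = 1
  combo : ∀ x, x = s x • a + m x • b + t x • c
  mem : ∀ x, x ∈ triangle a b c ↔ 0 ≤ s x ∧ 0 ≤ m x ∧ 0 ≤ t x

lemma exists_isBarycentric {a b c : Pt} (h : ¬ Collinear ℝ {a, b, c}) :
    ∃ s m t, IsBarycentric a b c s m t := by
  obtain ⟨s, m, t, h1, h2, h3, h4, h5, h6⟩ := exists_barycentric h
  exact ⟨s, m, t, h1.1, h1.2.1, h1.2.2, h2.1, h2.2.1, h2.2.2, h3.1, h3.2.1, h3.2.2, h4, h5, h6⟩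

namespace IsBarycentric
variable {a b c : Pt} {s m t : Pt →ᵃ[ℝ] ℝ} (B : IsBarycentric a b c s m t)
include B

lemma symm : IsBarycentric c b a t m s where
  sa := B.tc
  ma := B.mc
  ta := B.sc
  sb := B.tb
  mb := B.mb
  tb := B.sb
  sc := B.ta
  mc := B.ma
  tc := B.sa
  sum x := by linarith [B.sum x]
  combo x := by
    conv_lhs => rw [B.combo x]
    abel
  mem x := by
    have : triangle c b a = triangle a b c := by
      simp only [triangle]; congr 1; ext; simp; tauto
    rw [this, B.mem]; tauto

lemma mem_ab {x : Pt} (h1 : 0 ≤ s x) (h2 : 0 ≤ m x) (h : t x = 0) : x ∈ segment ℝ a b := by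
  refine ⟨s x, m x, h1, h2, ?_, ?_⟩
  · linarith [B.sum x]
  · conv_rhs => rw [B.combo x, h]
    simp

lemma mem_bc {x : Pt} (h1 : 0 ≤ t x) (h2 : 0 ≤ m x) (h : s x = 0) : x ∈ segment ℝ b c := by
  rw [segment_symm]; exact B.symm.mem_ab h1 h2 h

lemma of_mem_ab {x : Pt} (h : x ∈ segment ℝ a b) : t x = 0 := by
  obtain ⟨u, v, -, -, huv, rfl⟩ := h
  rw [affine_segment huv, B.ta, B.tb]; simp

lemma of_mem_bc {x : Pt} (h : x ∈ segment ℝ b c) : s x = 0 := by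
  rw [segment_symm] at h; exact B.symm.of_mem_ab h

lemma of_mem_ac {x : Pt} (h : x ∈ segment ℝ a c) : m x = 0 := by
  obtain ⟨u, v, -, -, huv, rfl⟩ := h
  rw [affine_segment huv, B.ma, B.mc]; simp

lemma eq_left {x : Pt} (h1 : t x = 0) (h2 : m x = 0) : x = a := by
  have : s x = 1 := by linarith [B.sum x]
  rw [B.combo x, h1, h2, this]; simp

lemma eq_right {x : Pt} (h1 : s x = 0) (h2 : m x = 0) : x = c := B.symm.eq_left h1 h2

lemma combo_sub (x y : Pt) : s x • (a - y) + m x • (b - y) + t x • (c - y) = x - y := by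
  have h : (s x + m x + t x) • y = y := by rw [B.sum, one_smul]
  conv_rhs => rw [B.combo x, ← h]
  module

end IsBarycentric

/-! ### Shortcuts of paths in a triangle -/

/-- The path `ρ` runs from `a` to `c` inside the triangle `abc` and meets the polygon
`a :: b :: c :: l` in its endpoints only. -/
def IsFreePath (a b c : Pt) (l ρ : List Pt) : Prop :=
  IsPathInTriangle a b c ρ ∧ pathCarrier ρ ∩ boundary (a :: b :: c :: l) ⊆ {a, c}

lemma segment_ab_subset_boundary (a b c : Pt) (l : List Pt) :
    segment ℝ a b ⊆ boundary (a :: b :: c :: l) := by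
  rw [boundary_three]; exact Set.subset_union_left.trans Set.subset_union_left

lemma segment_bc_subset_boundary (a b c : Pt) (l : List Pt) :
    segment ℝ b c ⊆ boundary (a :: b :: c :: l) := by
  rw [boundary_three]; exact Set.subset_union_right.trans Set.subset_union_left

lemma IsFreePath.eq_left {a b c : Pt} {l ρ : List Pt} {s m t : Pt →ᵃ[ℝ] ℝ} (h : IsFreePath a b c l ρ)
    (B : IsBarycentric a b c s m t) {v : Pt} (hv : v ∈ ρ) (ht : t v = 0) : v = a := by
  have hvt := (B.mem v).1 (h.1.2.2 (mem_pathCarrier hv))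
  rcases h.2 ⟨mem_pathCarrier hv, segment_ab_subset_boundary a b c l (B.mem_ab hvt.1 hvt.2.1 ht)⟩
    with h' | h'
  · exact h'
  · rw [Set.mem_singleton_iff] at h'
    rw [h', B.tc] at ht; norm_num at ht

lemma IsFreePath.eq_right {a b c : Pt} {l ρ : List Pt} {s m t : Pt →ᵃ[ℝ] ℝ}
    (h : IsFreePath a b c l ρ) (B : IsBarycentric a b c s m t) {v : Pt} (hv : v ∈ ρ)
    (hs : s v = 0) : v = c := by
  have hvt := (B.mem v).1 (h.1.2.2 (mem_pathCarrier hv))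
  rcases h.2 ⟨mem_pathCarrier hv, segment_bc_subset_boundary a b c l (B.mem_bc hvt.2.2 hvt.2.1 hs)⟩
    with h' | h'
  · rw [h', B.sa] at hs; norm_num at hs
  · exact h'

lemma affine_sub (f : Pt →ᵃ[ℝ] ℝ) (x y : Pt) : f.linear (x - y) = f x - f y := by
  simpa using f.linearMap_vsub x y

/-- A functional whose minimum over a free path is attained at `p` and `q` cuts off a region near
`b` that the polygon does not enter between `p` and `q`. -/
lemma segment_inter_boundary {a b c : Pt} {l ρ : List Pt} {s m t : Pt →ᵃ[ℝ] ℝ}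
    (B : IsBarycentric a b c s m t) (hS : IsSimplePolygon (a :: b :: c :: l))
    (hρ : IsFreePath a b c l ρ) {g : Pt} (hg : g ∈ segment ℝ a c)
    (hgb : g ∈ boundary (a :: b :: c :: l)) (hga : g ≠ a) (hgc : g ≠ c)
    {r : ℝ} (hr : r ∈ Set.Icc (0 : ℝ) 1) {p q : Pt} (hp : p ∈ ρ) (hq : q ∈ ρ)
    (hp' : ∀ v ∈ ρ, r * s p + (1 - r) * t p ≤ r * s v + (1 - r) * t v)
    (hpq : r * s p + (1 - r) * t p = r * s q + (1 - r) * t q) :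
    segment ℝ p q ∩ boundary (a :: b :: c :: l) ⊆ {a, c} := by
  have hfree := hρ
  obtain ⟨⟨hhead, hlast, hcar⟩, hint⟩ := hρ
  rintro x ⟨hx, hxb⟩
  by_contra hxac
  have hxρ : x ∉ pathCarrier ρ := fun h => hxac (hint ⟨h, hxb⟩)
  have hpt := (B.mem p).1 (hcar (mem_pathCarrier hp))
  have hqt := (B.mem q).1 (hcar (mem_pathCarrier hq))
  have hxt := (B.mem x).1 (segment_subset_triangle (hcar (mem_pathCarrier hp))
    (hcar (mem_pathCarrier hq)) hx)
  have hρt : ∀ v ∈ ρ, t v = 0 → v = a := fun v hv => hfree.eq_left B hv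
  have hρs : ∀ v ∈ ρ, s v = 0 → v = c := fun v hv => hfree.eq_right B hv
  obtain ⟨u, v, hu, hv, huv, hxe⟩ := hx
  have hu0 : 0 < u := hu.lt_of_ne fun h => by
    rw [← h] at huv hxe
    simp only [zero_add] at huv
    rw [huv, zero_smul, zero_add, one_smul] at hxe
    exact hxρ (hxe ▸ mem_pathCarrier hq)
  have hv0 : 0 < v := hv.lt_of_ne fun h => by
    rw [← h] at huv hxe
    simp only [add_zero] at huv
    rw [huv, zero_smul, add_zero, one_smul] at hxe
    exact hxρ (hxe ▸ mem_pathCarrier hp)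
  have hxs : s x = u * s p + v * s q := by rw [← hxe, affine_segment huv]
  have hxt' : t x = u * t p + v * t q := by rw [← hxe, affine_segment huv]
  have htx : 0 < t x := hxt.2.2.lt_of_ne fun h => by
    have h1 : t p = 0 := by nlinarith [mul_nonneg hu hpt.2.2, mul_nonneg hv hqt.2.2]
    have h2 : t q = 0 := by nlinarith [mul_nonneg hu hpt.2.2, mul_nonneg hv hqt.2.2]
    rw [hρt p hp h1, hρt q hq h2, ← add_smul, huv, one_smul] at hxe
    exact hxac (Or.inl hxe.symm)
  have hsx : 0 < s x := hxt.1.lt_of_ne fun h => by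
    have h1 : s p = 0 := by nlinarith [mul_nonneg hu hpt.1, mul_nonneg hv hqt.1]
    have h2 : s q = 0 := by nlinarith [mul_nonneg hu hpt.1, mul_nonneg hv hqt.1]
    rw [hρs p hp h1, hρs q hq h2, ← add_smul, huv, one_smul] at hxe
    exact hxac (Or.inr hxe.symm)
  have hxab : x ∉ segment ℝ a b := fun h => htx.ne' (B.of_mem_ab h)
  have hxbc : x ∉ segment ℝ b c := fun h => hsx.ne' (B.of_mem_bc h)
  have hmg := B.of_mem_ac hg
  have hgab : g ∉ segment ℝ a b := fun h => hga (B.eq_left (B.of_mem_ab h) hmg)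
  have hgbc : g ∉ segment ℝ b c := fun h => hgc (B.eq_right (B.of_mem_bc h) hmg)
  have hgρ : g ∉ pathCarrier ρ := fun h => by
    rcases hint ⟨h, hgb⟩ with h | h
    · exact hga h
    · exact hgc h
  have habc : ∀ y, y ∉ segment ℝ a b → y ∉ segment ℝ b c → y ∉ pathCarrier [a, b, c] := by
    intro y h1 h2
    rw [pathCarrier_cons_cons, pathCarrier_cons_cons, pathCarrier_singleton]
    rintro (h | h | h)
    · exact h1 h
    · exact h2 h
    · exact h2 (h ▸ right_mem_segment ℝ _ _)
  -- on the side `ac` of the triangle the angle sums agree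
  have hD : pairSum (ang g) [a, b, c] = pairSum (ang g) ρ := by
    obtain ⟨w, hw⟩ := exists_linear_eq_re m.linear
    have hw0 : w ≠ 0 := by
      rintro rfl
      have := hw (b - a)
      rw [affine_sub, B.mb, B.ma] at this
      simp at this
    have hside : ∀ y, 0 ≤ m y → 0 ≤ (toC (y - g) * w).re := fun y hy => by
      rw [← hw, affine_sub, hmg]; linarith
    rw [angSum_of_re_nonneg hw0 hhead hlast hgρ, angSum_of_re_nonneg hw0 (p := a) (q := c) rfl rfl
      (habc g hgab hgbc)]
    · simp only [List.forall_mem_cons]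
      exact ⟨hside a B.ma.ge, hside b (by rw [B.mb]; norm_num), hside c B.mc.ge, by simp⟩
    · exact fun v hv => hside v ((B.mem v).1 (hcar (mem_pathCarrier hv))).2.1
  have hxr : x ∈ pathCarrier (c :: (l ++ [a])) \ {a, c} := by
    rw [boundary_three] at hxb
    exact ⟨(hxb.resolve_left (not_or.2 ⟨hxab, hxbc⟩)), hxac⟩
  have hgr : g ∈ pathCarrier (c :: (l ++ [a])) \ {a, c} := by
    rw [boundary_three] at hgb
    exact ⟨(hgb.resolve_left (not_or.2 ⟨hgab, hgbc⟩)), by simp [hga, hgc]⟩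
  -- The part of the polygon from `c` back to `a`, without these ends, is connected, avoids both
  -- paths and contains `g` and `x`.
  have hD' : pairSum (ang x) [a, b, c] = pairSum (ang x) ρ := by
    refine angSum_sub_eq (p := a) (q := c) rfl rfl hhead hlast hS.isPreconnected_rest ?_ ?_ hgr hxr
      hD
    · intro y hy
      have : ∀ h : y ∈ segment ℝ a b ∪ segment ℝ b c, False := fun h => by
        have hy1 := hy.1
        rw [pathCarrier_append_singleton] at hy1
        obtain ⟨e, he, hye⟩ := hy1
        exact hy.2 (hS.edge_inter he hye h)
      exact habc y (fun h => this (Or.inl h)) (fun h => this (Or.inr h))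
    · intro y hy h
      exact hy.2 (hint ⟨h, by rw [boundary_three]; exact Or.inr hy.1⟩)
  -- at `x` they do not
  set f : Pt →ᵃ[ℝ] ℝ := r • s + (1 - r) • t with hf
  have hfv : ∀ y, f y = r * s y + (1 - r) * t y := fun y => by simp [hf]
  have hfx : f x = r * s p + (1 - r) * t p := by
    rw [hfv, hxs, hxt']; linear_combination (-v) * hpq + (r * s p + (1 - r) * t p) * huv
  obtain ⟨w, hw⟩ := exists_linear_eq_re f.linear
  -- `f` is zero at `b` and positive at `x`, so the line through `x` on which `f` is constant
  -- separates `b` from `ρ`. This is the situation of `arg_add_arg_ne`.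
  have hfb : f b < f x := by
    rw [hfv, hfv, B.sb, B.tb]
    rcases hr.1.eq_or_lt with h | h
    · rw [← h]; linarith
    · nlinarith [mul_pos h hsx, mul_nonneg (sub_nonneg.2 hr.2) htx.le]
  have hbre : (toC (b - x) * w).re < 0 := by rw [← hw, affine_sub]; linarith
  have hw0 : w ≠ 0 := by rintro rfl; simp at hbre
  have hside : ∀ y ∈ ρ, 0 ≤ (toC (y - x) * w).re := fun y hy => by
    rw [← hw, affine_sub, hfx, hfv]; linarith [hp' y hy]
  have haρ : a ∈ ρ := List.mem_of_head? hhead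
  have hcρ : c ∈ ρ := List.mem_of_getLast? hlast
  have hxa : x ≠ a := fun h => hxac (Or.inl h)
  have hxc : x ≠ c := fun h => hxac (Or.inr h)
  rw [angSum_of_re_nonneg hw0 hhead hlast hxρ hside] at hD'
  simp only [pairSum_cons_cons, pairSum_singleton, add_zero, ang] at hD'
  have s1 := div_mem_slitPlane hxab
  have s2 := div_mem_slitPlane hxbc
  rw [← mul_div_mul_right _ _ hw0] at s1 s2
  rw [← mul_div_mul_right (toC (b - x)) _ hw0, ← mul_div_mul_right (toC (c - x)) _ hw0] at hD'
  refine arg_add_arg_ne (mul_ne_zero (toC_sub_ne_zero hxa) hw0)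
    (mul_ne_zero (toC_sub_ne_zero hxc) hw0) (hside a haρ) (hside c hcρ) hbre hxt.1 hxt.2.1 hxt.2.2
    (B.sum x) ?_ s1 s2 hD'
  have := congrArg toC (B.combo_sub x x)
  simp only [map_add, map_smul, Complex.real_smul, sub_self, map_zero] at this
  linear_combination w * this

open Filter Topology

lemma IsBarycentric.apply {a b c : Pt} {s m t : Pt →ᵃ[ℝ] ℝ} (B : IsBarycentric a b c s m t)
    (f : Pt →ᵃ[ℝ] ℝ) (x : Pt) : f x = s x * f a + m x * f b + t x * f c := by
  have h := congrArg f.linear (B.combo_sub x b)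
  simp only [map_add, map_smul, affine_sub, smul_eq_mul] at h
  linear_combination -h - f b * B.sum x

/-- If no shortcut of a free path is free, then the path is convex towards `b`. -/
lemma IsFreePath.convex {a b c : Pt} {l ρ : List Pt} (hb : b ∉ segment ℝ a c)
    (hS : IsSimplePolygon (a :: b :: c :: l)) (hρ : IsFreePath a b c l ρ) {g : Pt}
    (hg : g ∈ segment ℝ a c) (hgb : g ∈ boundary (a :: b :: c :: l)) (hga : g ≠ a) (hgc : g ≠ c)
    (hsc : ∀ i k (hk : k < ρ.length) (hik : i + 2 ≤ k),
      ¬ segment ℝ ρ[i] ρ[k] ∩ boundary (a :: b :: c :: l) ⊆ {a, c})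
    (f : Pt →ᵃ[ℝ] ℝ) (hfb : 0 < f b) {i j k : ℕ} (hij : i < j) (hjk : j < k) (hk : k < ρ.length)
    (hi : 0 < f ρ[i]) (hj : f ρ[j] < 0) (hk' : 0 < f ρ[k]) : False := by
  obtain ⟨s, m, t, B⟩ := exists_isBarycentric (hS.not_collinear hb)
  set N := ρ.length - 1 with hN
  have hlen : ∀ {n}, n ≤ N → n < ρ.length := by intro n hn; omega
  have hget : ∀ {n} (hn : n < ρ.length), ρ.getD n a = ρ[n] := fun hn => List.getD_eq_getElem _ _ hn
  have hmem : ∀ {n}, n ≤ N → ρ.getD n a ∈ ρ := fun hn => by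
    rw [hget (hlen hn)]; exact List.getElem_mem _
  have htri : ∀ {n}, n ≤ N → 0 ≤ s (ρ.getD n a) ∧ 0 ≤ t (ρ.getD n a) := fun hn => by
    have := (B.mem _).1 (hρ.1.2.2 (mem_pathCarrier (hmem hn)))
    exact ⟨this.1, this.2.2⟩
  have h0 : ρ.getD 0 a = a := by
    rw [hget (by omega)]
    have := hρ.1.1
    rw [List.head?_eq_getElem?, List.getElem?_eq_getElem (by omega)] at this
    simpa using this
  have h1 : ρ.getD N a = c := by
    rw [hget (by omega)]
    have := hρ.1.2.1
    rw [List.getLast?_eq_getElem?, List.getElem?_eq_getElem (by omega)] at this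
    simpa using this
  -- A vertex skipped between two simultaneous minimizers would give a free shortcut.
  have H : NoSkip (fun n => s (ρ.getD n a)) (fun n => t (ρ.getD n a)) N := by
    intro r hr p j q hpj hjq hp hq
    have hp' := hlen hp.1
    have hq' := hlen hq.1
    apply hsc p q hq' (by omega)
    have hle : ∀ v ∈ ρ, r * s ρ[p] + (1 - r) * t ρ[p] ≤ r * s v + (1 - r) * t v := by
      intro v hv
      obtain ⟨n, hn, rfl⟩ := List.getElem_of_mem hv
      have := hp.2 n (by omega)
      simpa only [hget hp', hget hn] using this
    refine segment_inter_boundary B hS hρ hg hgb hga hgc hr (List.getElem_mem _)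
      (List.getElem_mem _) hle (le_antisymm (hle _ (List.getElem_mem _)) ?_)
    have := hq.2 p hp.1
    simpa only [hget hp', hget hq'] using this
  have hkN : k ≤ N := by omega
  -- In the coordinates `s`, `t` the corner `b` is the origin, and positivity of `f` reads `(f b - f
  -- a) * s + (f b - f c) * t < f b`.
  have hf : ∀ {n} (hn : n < ρ.length), f ρ[n] =
      f b - ((f b - f a) * s (ρ.getD n a) + (f b - f c) * t (ρ.getD n a)) := fun {n} hn => by
    rw [hget hn, B.apply f ρ[n]]
    linear_combination f b * B.sum ρ[n]
  refine not_separated_of_noSkip H ⟨Nat.zero_le _, fun n hn => ?_⟩ ⟨le_rfl, fun n hn => ?_⟩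
    (fun n hn he => ?_) (fun n hn he => ?_) (fun n hn => (htri hn).1) (fun n hn => (htri hn).2)
    hij hjk hkN hfb (x := f b - f a) (y := f b - f c) ?_ ?_ ?_
  · simp only [h0, B.sa, B.ta]
    linarith [(htri hn).2]
  · simp only [h1, B.sc, B.tc]
    linarith [(htri hn).1]
  · simp only [h0, B.ta, B.sa] at he ⊢
    rw [hρ.eq_left B (hmem hn) he, B.sa]
  · simp only [h1, B.sc, B.tc] at he ⊢
    rw [hρ.eq_right B (hmem hn) he, B.tc]
  · have := hf (hjk.trans hk); linarith
  · have := hf (hij.trans (hjk.trans hk)); linarith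
  · have := hf hk; linarith

/-! ### Shortcuts of lists -/

/-- The path `ρ` with its vertices between the `i`-th and the `k`-th removed. -/
def shortcut {α : Type*} (ρ : List α) (i k : ℕ) : List α := ρ.take (i + 1) ++ ρ.drop k

section shortcut
variable {α : Type*} {ρ : List α} {i k : ℕ}

lemma shortcut_eq (hik : i + 2 ≤ k) (hk : k < ρ.length) :
    shortcut ρ i k = ρ.take i ++ ρ[i] :: ρ[k] :: ρ.drop (k + 1) := by
  rw [shortcut, List.take_succ_eq_append_getElem (by omega), List.drop_eq_getElem_cons hk,
    List.append_assoc]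
  rfl

lemma eq_of_shortcut (hik : i + 2 ≤ k) (hk : k < ρ.length) :
    ∃ mid, ρ = ρ.take i ++ ρ[i] :: (mid ++ ρ[k] :: ρ.drop (k + 1)) := by
  refine ⟨(ρ.drop (i + 1)).take (k - (i + 1)), ?_⟩
  conv_lhs => rw [← List.take_append_drop i ρ, List.drop_eq_getElem_cons (by omega : i < ρ.length),
    ← List.take_append_drop (k - (i + 1)) (ρ.drop (i + 1)), List.drop_drop,
    show i + 1 + (k - (i + 1)) = k by omega, List.drop_eq_getElem_cons hk]

lemma length_shortcut_lt (hik : i + 2 ≤ k) (hk : k < ρ.length) :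
    (shortcut ρ i k).length < ρ.length := by
  simp [shortcut]; omega

lemma shortcut_subset {p : α} (hp : p ∈ shortcut ρ i k) : p ∈ ρ := by
  rcases List.mem_append.1 hp with h | h
  · exact List.mem_of_mem_take h
  · exact List.mem_of_mem_drop h

lemma head?_shortcut (hik : i + 2 ≤ k) (hk : k < ρ.length) :
    (shortcut ρ i k).head? = ρ.head? := by
  obtain ⟨mid, h⟩ := eq_of_shortcut hik hk
  rw [shortcut_eq hik hk]
  conv_rhs => rw [h]
  cases ρ.take i <;> simp

lemma getLast?_shortcut (hk : k < ρ.length) :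
    (shortcut ρ i k).getLast? = ρ.getLast? := by
  rw [shortcut, List.getLast?_append, List.getLast?_drop]
  have : ρ.getLast? ≠ none := by
    rw [ne_eq, List.getLast?_eq_none_iff]; rintro rfl; simp at hk
  cases h : ρ.getLast? with
  | none => exact absurd h this
  | some x => simp [hk]

/-- The removed part `mid` is fixed before the weight, so that the comparison of lengths and that of
crossings concern the same vertices. -/
lemma pairSum_shortcut (hik : i + 2 ≤ k) (hk : k < ρ.length) :
    ∃ mid, (∀ v ∈ ρ[i] :: (mid ++ [ρ[k]]), v ∈ ρ) ∧
      ∀ {β : Type} [AddCommMonoid β] (w : α → α → β),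
        ∃ u, pairSum w (shortcut ρ i k) = u + w ρ[i] ρ[k] ∧
          pairSum w ρ = u + pairSum w (ρ[i] :: (mid ++ [ρ[k]])) := by
  obtain ⟨mid, h⟩ := eq_of_shortcut hik hk
  refine ⟨mid, fun v hv => ?_, fun w => ⟨pairSum w (ρ.take i ++ [ρ[i]]) +
    pairSum w (ρ[k] :: ρ.drop (k + 1)), ?_, ?_⟩⟩
  · rw [h]
    simp only [List.mem_append, List.mem_cons, List.not_mem_nil, or_false] at hv ⊢
    tauto
  · rw [shortcut_eq hik hk, pairSum_append_cons, pairSum_cons_cons]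
    abel
  · conv_lhs => rw [h, pairSum_append_cons, ← List.cons_append,
      pairSum_append_cons w (ρ[i] :: mid) ρ[k]]
    rw [List.cons_append]
    abel

end shortcut

lemma pathCarrier_append_cons (L : List Pt) (p : Pt) (M : List Pt) :
    pathCarrier (L ++ p :: M) = pathCarrier (L ++ [p]) ∪ pathCarrier (p :: M) := by
  induction L with
  | nil =>
    rw [List.nil_append, List.nil_append, pathCarrier_singleton, Set.union_eq_self_of_subset_left]
    simpa using mem_pathCarrier (List.mem_cons_self (a := p) (l := M))
  | cons x L ih =>
    cases L with
    | nil =>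
      simp only [List.cons_append, List.nil_append, pathCarrier_cons_cons, pathCarrier_singleton]
      rw [Set.union_assoc]
      congr 1
      rw [Set.union_eq_self_of_subset_left]
      simpa using mem_pathCarrier (List.mem_cons_self (a := p) (l := M))
    | cons y L =>
      simp only [List.cons_append, pathCarrier_cons_cons] at ih ⊢
      rw [ih, Set.union_assoc]

lemma pathCarrier_shortcut {ρ : List Pt} {i k : ℕ} (hik : i + 2 ≤ k) (hk : k < ρ.length) :
    pathCarrier (shortcut ρ i k) ⊆ pathCarrier ρ ∪ segment ℝ ρ[i] ρ[k] := by
  obtain ⟨mid, h⟩ := eq_of_shortcut hik hk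
  rw [shortcut_eq hik hk, pathCarrier_append_cons, pathCarrier_cons_cons]
  have h1 : pathCarrier ρ = pathCarrier (ρ.take i ++ [ρ[i]]) ∪ (pathCarrier (ρ[i] :: (mid ++ [ρ[k]]))
      ∪ pathCarrier (ρ[k] :: ρ.drop (k + 1))) := by
    conv_lhs => rw [h, pathCarrier_append_cons, ← List.cons_append,
      pathCarrier_append_cons (ρ[i] :: mid) ρ[k]]
    rw [List.cons_append]
  rw [h1]
  rintro x (hx | hx | hx)
  · exact Or.inl (Or.inl hx)
  · exact Or.inr hx
  · exact Or.inl (Or.inr (Or.inr hx))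

lemma IsPathInTriangle.shortcut {a b c : Pt} {ρ : List Pt} (h : IsPathInTriangle a b c ρ) {i k : ℕ}
    (hik : i + 2 ≤ k) (hk : k < ρ.length) : IsPathInTriangle a b c (shortcut ρ i k) := by
  refine ⟨(head?_shortcut hik hk).trans h.1, (getLast?_shortcut hk).trans h.2.1,
    (pathCarrier_shortcut hik hk).trans (Set.union_subset h.2.2 ?_)⟩
  exact segment_subset_triangle (h.2.2 (mem_pathCarrier (List.getElem_mem _)))
    (h.2.2 (mem_pathCarrier (List.getElem_mem _)))

lemma IsPerturbation.shortcut {ε : ℝ} {ρ ρ' : List Pt} (h : IsPerturbation ε ρ ρ') (i k : ℕ) :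
    IsPerturbation ε (shortcut ρ i k) (shortcut ρ' i k) :=
  List.rel_append (List.forall₂_take _ h) (List.forall₂_drop _ h)

lemma IsPerturbation.mono {ε ε' : ℝ} {l l' : List Pt} (h : IsPerturbation ε l l') (hε : ε ≤ ε') :
    IsPerturbation ε' l l' :=
  List.Forall₂.imp (fun _ _ h => h.trans hε) h

/-- A straight path crosses every line at most once. -/
lemma pairSum_sep_of_straight {A : Set Pt} {f : Pt →ᵃ[ℝ] ℝ} {p q : Pt} {mid : List Pt}
    (hA : ∀ v ∈ p :: (mid ++ [q]), (v ∈ A ↔ 0 < f v) ∧ f v ≠ 0)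
    (h : pairSum dist (p :: (mid ++ [q])) ≤ dist p q) :
    pairSum (sep A) (p :: (mid ++ [q])) = sep A p q := by
  induction mid generalizing p with
  | nil => simp
  | cons v mid ih =>
    rw [List.cons_append, pairSum_cons_cons] at h ⊢
    have h1 := dist_le_pairSum v mid q
    have h2 := dist_triangle p v q
    rw [ih (fun w hw => hA w (by simpa using Or.inr (by simpa using hw))) (by linarith)]
    -- No room is left in the triangle inequality. A point of the segment off the line shares its
    -- side with an end, so inserting it adds no crossing.
    have hv : v ∈ segment ℝ p q := by
      rw [mem_segment_iff_wbtw, ← dist_add_dist_eq_iff]; linarith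
    obtain ⟨u, w, hu, hw, huw, rfl⟩ := hv
    have hp := hA p (by simp)
    have hq := hA q (by simp)
    have hv := hA (u • p + w • q) (by simp)
    rw [affine_segment huw] at hv
    rcases lt_or_gt_of_ne hp.2 with h3 | h3 <;> rcases lt_or_gt_of_ne hq.2 with h4 | h4
    · have : u * f p + w * f q ≤ 0 := by nlinarith
      simp only [sep, hp.1, hq.1, hv.1]
      simp [h3.not_gt, h4.not_gt, this.not_gt]
    · simp only [sep, hp.1, hq.1, hv.1]
      split_ifs <;> grind
    · simp only [sep, hp.1, hq.1, hv.1]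
      split_ifs <;> grind
    · have : 0 ≤ u * f p + w * f q := by nlinarith
      have := this.lt_of_ne hv.2.symm
      simp only [sep, hp.1, hq.1, hv.1]
      simp [h3, h4, this]

/-! ### Shortest paths cross no line more often than the two edges they replace -/

/-- After some `ε`-perturbation the path `ρ` is free. -/
def IsFreeAt (a b c : Pt) (rest ρ : List Pt) (ε : ℝ) : Prop :=
  ∃ (a' b' c' : Pt) (rest' ρ' : List Pt),
    IsPerturbation ε (a :: b :: c :: rest) (a' :: b' :: c' :: rest') ∧
    IsSimplePolygon (a' :: b' :: c' :: rest') ∧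
    IsPerturbation ε ρ ρ' ∧ IsFreePath a' b' c' rest' ρ'

lemma isNonCrossingPath_iff {a b c : Pt} {rest ρ : List Pt} : IsNonCrossingPath a b c rest ρ ↔
    IsPathInTriangle a b c ρ ∧ ∀ ε > 0, IsFreeAt a b c rest ρ ε := Iff.rfl

lemma IsFreeAt.mono {a b c : Pt} {rest ρ : List Pt} {ε ε' : ℝ} (h : IsFreeAt a b c rest ρ ε)
    (hε : ε ≤ ε') : IsFreeAt a b c rest ρ ε' := by
  obtain ⟨a', b', c', rest', ρ', h1, h2, h3, h4⟩ := h
  exact ⟨a', b', c', rest', ρ', h1.mono hε, h2, h3.mono hε, h4⟩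

/-- Freeness at `ε` implies freeness at every larger value, so failure persists downwards and
finitely many failures have a common `ε`. -/
lemma eventually_not_isFreeAt {a b c : Pt} {rest ρ : List Pt}
    (h : ¬ ∀ ε > 0, IsFreeAt a b c rest ρ ε) :
    ∀ᶠ ε in 𝓝[>] (0 : ℝ), ¬ IsFreeAt a b c rest ρ ε := by
  push Not at h
  obtain ⟨ε, hε, h⟩ := h
  filter_upwards [Ioo_mem_nhdsGT hε] with δ hδ h'
  exact h (h'.mono hδ.2.le)

/-! ### Stability of open conditions under small perturbations -/

lemma eventually_forall_dist_le {p : Pt} {P : Pt → Prop} (h : ∀ᶠ q in 𝓝 p, P q) :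
    ∀ᶠ ε in 𝓝[>] (0 : ℝ), ∀ q, dist p q ≤ ε → P q := by
  obtain ⟨δ, hδ, h⟩ := Metric.eventually_nhds_iff.1 h
  filter_upwards [Ioo_mem_nhdsGT hδ] with ε hε q hq
  exact h (by rw [dist_comm]; exact hq.trans_lt hε.2)

lemma eventually_notMem_segment {a b c : Pt} (h : b ∉ segment ℝ a c) :
    ∀ᶠ ε in 𝓝[>] (0 : ℝ), ∀ a' b' c', dist a a' ≤ ε → dist b b' ≤ ε → dist c c' ≤ ε →
      b' ∉ segment ℝ a' c' := by
  have hcl : IsClosed (segment ℝ a c) := by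
    rw [segment_eq_image_lineMap]
    exact (isCompact_Icc.image (by fun_prop)).isClosed
  have hne : (segment ℝ a c).Nonempty := ⟨a, left_mem_segment ℝ _ _⟩
  have hpos := (hcl.notMem_iff_infDist_pos hne).1 h
  filter_upwards [Ioo_mem_nhdsGT (half_pos hpos)] with ε hε a' b' c' ha hb hc hmem
  obtain ⟨u, v, hu, hv, huv, rfl⟩ := hmem
  have h1 : Metric.infDist b (segment ℝ a c) ≤ dist b (u • a + v • c) :=
    Metric.infDist_le_dist_of_mem ⟨u, v, hu, hv, huv, rfl⟩
  have h2 : dist (u • a' + v • c') (u • a + v • c) ≤ u * ε + v * ε := by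
    refine (dist_add_add_le _ _ _ _).trans (add_le_add ?_ ?_)
    · rw [dist_smul₀, Real.norm_of_nonneg hu, dist_comm]; gcongr
    · rw [dist_smul₀, Real.norm_of_nonneg hv, dist_comm]; gcongr
  have h3 := dist_triangle b (u • a' + v • c') (u • a + v • c)
  have h4 : u * ε + v * ε = ε := by rw [← add_mul, huv, one_mul]
  linarith [hε.2]

lemma eventually_sign {f : Pt →ᵃ[ℝ] ℝ} {p : Pt} (hp : f p ≠ 0) :
    ∀ᶠ ε in 𝓝[>] (0 : ℝ), ∀ q, dist p q ≤ ε → (0 < f p → 0 < f q) ∧ (f p < 0 → f q < 0) := by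
  apply eventually_forall_dist_le
  have hc : ContinuousAt f p := f.continuous_of_finiteDimensional.continuousAt
  rcases lt_or_gt_of_ne hp with h | h
  · filter_upwards [hc.eventually_lt_const h] with q hq
    exact ⟨fun h' => by linarith, fun _ => hq⟩
  · filter_upwards [hc.eventually_const_lt h] with q hq
    exact ⟨fun _ => hq, fun h' => by linarith⟩

/-- If no shortcut of the path is non-crossing, then the path is convex towards `b`. -/
lemma false_of_no_shortcut {a b c : Pt} {rest ρ : List Pt} (hb : b ∉ segment ℝ a c)
    (hρ : ∀ ε > 0, IsFreeAt a b c rest ρ ε) (hac : ¬ ∀ ε > 0, IsFreeAt a b c rest [a, c] ε)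
    (hsc : ∀ i k, i + 2 ≤ k → k < ρ.length → ¬ ∀ ε > 0, IsFreeAt a b c rest (shortcut ρ i k) ε)
    (f : Pt →ᵃ[ℝ] ℝ) (hfb : 0 < f b) {i j k : ℕ} (hij : i < j) (hjk : j < k) (hk : k < ρ.length)
    (hi : 0 < f ρ[i]) (hj : f ρ[j] < 0) (hk' : 0 < f ρ[k]) : False := by
  have hall : ∀ᶠ ε in 𝓝[>] (0 : ℝ), ∀ i ∈ Set.Iio ρ.length, ∀ k ∈ Set.Iio ρ.length, i + 2 ≤ k →
      ¬ IsFreeAt a b c rest (shortcut ρ i k) ε := by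
    refine (eventually_all_finite (Set.finite_Iio _)).2 fun i _ =>
      (eventually_all_finite (Set.finite_Iio _)).2 fun k hk => ?_
    by_cases h : i + 2 ≤ k
    · exact (eventually_not_isFreeAt (hsc i k h hk)).mono fun _ h' _ => h'
    · exact Eventually.of_forall fun _ h' => absurd h' h
  -- A single `ε` at which neither `ac` nor any shortcut is free, `b` stays off the opposite side,
  -- and the signs of `f` at the four relevant points persist.
  obtain ⟨ε, hsc, hac, hseg, sb, si, sj, sk, hε⟩ := (hall.and <| (eventually_not_isFreeAt hac).and <|
    (eventually_notMem_segment hb).and <| (eventually_sign hfb.ne').and <|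
    (eventually_sign hi.ne').and <| (eventually_sign hj.ne).and <|
    (eventually_sign hk'.ne').and self_mem_nhdsWithin).exists
  obtain ⟨a', b', c', rest', ρ', hpert, hS, hρρ', hfree⟩ := hρ ε hε
  have hpert' := hpert
  simp only [IsPerturbation, List.forall₂_cons] at hpert'
  obtain ⟨da, db, dc, -⟩ := hpert'
  have hlen : ρ.length = ρ'.length := hρρ'.length_eq
  have hd : ∀ n (hn : n < ρ.length), dist ρ[n] (ρ'[n]'(hlen ▸ hn)) ≤ ε := fun n hn =>
    List.Forall₂.get hρρ' hn (hlen ▸ hn)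
  have hb' := hseg a' b' c' da db dc
  -- The direct path is not free, so the polygon meets the side opposite to the perturbed `b` away
  -- from its ends. There the angle sums can be compared.
  obtain ⟨g, ⟨hg, hgb⟩, hgac⟩ : ∃ g, (g ∈ segment ℝ a' c' ∧ g ∈ boundary (a' :: b' :: c' :: rest')) ∧
      g ∉ ({a', c'} : Set Pt) := by
    by_contra! hc
    have hcar : pathCarrier [a', c'] = segment ℝ a' c' := by
      rw [pathCarrier_cons_cons, pathCarrier_singleton]
      exact Set.union_eq_self_of_subset_right (by simpa using right_mem_segment ℝ a' c')
    refine hac ⟨a', b', c', rest', [a', c'], hpert, hS, .cons da (.cons dc .nil),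
      ⟨rfl, rfl, ?_⟩, ?_⟩
    · rw [hcar]
      exact segment_subset_triangle (left_mem_triangle _ _ _) (right_mem_triangle _ _ _)
    · rw [hcar]; exact fun g hg => hc g hg
  simp only [Set.mem_insert_iff, Set.mem_singleton_iff, not_or] at hgac
  refine hfree.convex hb' hS hg hgb hgac.1 hgac.2 (fun i k hk hik hsub => ?_) f
    ((sb b' db).1 hfb) hij hjk (hlen ▸ hk) ((si _ (hd i _)).1 hi) ((sj _ (hd j _)).2 hj)
    ((sk _ (hd k _)).1 hk')
  refine hsc i (by simp; omega) k (by simp; omega) hik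
    ⟨a', b', c', rest', shortcut ρ' i k, hpert, hS, hρρ'.shortcut i k, hfree.1.shortcut hik hk, ?_⟩
  rintro x ⟨hx, hxb⟩
  rcases pathCarrier_shortcut hik hk hx with h | h
  · exact hfree.2 ⟨h, hxb⟩
  · exact hsub ⟨h, hxb⟩

lemma not_pattern_of_no_shortcut {a b c : Pt} {rest ρ : List Pt} (hb : b ∉ segment ℝ a c)
    (hρ : ∀ ε > 0, IsFreeAt a b c rest ρ ε) (hac : ¬ ∀ ε > 0, IsFreeAt a b c rest [a, c] ε)
    (hsc : ∀ i k, i + 2 ≤ k → k < ρ.length → ¬ ∀ ε > 0, IsFreeAt a b c rest (shortcut ρ i k) ε)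
    (f : Pt →ᵃ[ℝ] ℝ) (hfb : 0 < f b) {p q r : Pt} (h : [p, q, r].Sublist ρ)
    (hp : 0 < f p) (hq : f q < 0) (hr : 0 < f r) : False := by
  obtain ⟨e, he⟩ := List.sublist_iff_exists_fin_orderEmbedding_get_eq.1 h
  have h0 := he ⟨0, by simp⟩
  have h1 := he ⟨1, by simp⟩
  have h2 := he ⟨2, by simp⟩
  simp only [List.get_eq_getElem, List.getElem_cons_zero, List.getElem_cons_succ] at h0 h1 h2
  rw [h0] at hp
  rw [h1] at hq
  rw [h2] at hr
  refine false_of_no_shortcut hb hρ hac hsc f hfb (e.strictMono ?_) (e.strictMono ?_) (e _).2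
    hp hq hr <;> simp [Fin.lt_def]

/-- By induction on the number of vertices it suffices to treat a path without non-crossing
shortcuts; such a path is convex towards `b` unless `ac` itself is non-crossing. -/
lemma IsShortestPath.pairSum_sep_le {a b c : Pt} {rest : List Pt} (hb : b ∉ segment ℝ a c)
    {A : Set Pt} {f : Pt →ᵃ[ℝ] ℝ} (hAb : (b ∈ A ↔ 0 < f b) ∧ f b ≠ 0) {ρ : List Pt}
    (hρ : IsShortestPath a b c rest ρ) (hA : ∀ v ∈ ρ, (v ∈ A ↔ 0 < f v) ∧ f v ≠ 0) :
    pairSum (sep A) ρ ≤ sep A a b + sep A b c := by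
  induction hn : ρ.length using Nat.strong_induction_on generalizing ρ with
  | _ n ih =>
  subst hn
  have hnc := isNonCrossingPath_iff.1 hρ.1
  -- A non-crossing `ac` makes the shortest path straight, so it crosses the line no more than `ac`
  -- does.
  by_cases hac : ∀ ε > 0, IsFreeAt a b c rest [a, c] ε
  · have hle := hρ.2 [a, c] ⟨⟨rfl, rfl, by
      rw [pathCarrier_cons_cons, pathCarrier_singleton]
      exact Set.union_subset (segment_subset_triangle (left_mem_triangle _ _ _)
        (right_mem_triangle _ _ _)) (by simpa using right_mem_triangle a b c)⟩, hac⟩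
    simp only [pathLength_eq_pairSum, pairSum_cons_cons, pairSum_singleton, add_zero] at hle
    obtain ⟨l, rfl⟩ := List.head?_eq_some_iff.1 hnc.1.1
    rcases List.eq_nil_or_concat l with rfl | ⟨mid, z, rfl⟩
    · simp
    · rw [List.concat_eq_append] at *
      obtain rfl : z = c := by simpa [List.getLast?_cons] using hnc.1.2.1
      rw [pairSum_sep_of_straight hA hle]
      exact sep_triangle A a b z
  -- A non-crossing shortcut is again shortest. The part it bypasses was therefore straight, and the
  -- crossings do not change.
  by_cases hsc : ∃ i k, i + 2 ≤ k ∧ k < ρ.length ∧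
      ∀ ε > 0, IsFreeAt a b c rest (shortcut ρ i k) ε
  · obtain ⟨i, k, hik, hk, hfree⟩ := hsc
    have hnc' : IsNonCrossingPath a b c rest (shortcut ρ i k) := ⟨hnc.1.shortcut hik hk, hfree⟩
    obtain ⟨mid, hmid, hsum⟩ := pairSum_shortcut hik hk
    obtain ⟨u, hu, hu'⟩ := hsum dist
    have h1 := hρ.2 _ hnc'
    rw [pathLength_eq_pairSum, pathLength_eq_pairSum, hu, hu'] at h1
    have h2 := dist_le_pairSum ρ[i] mid ρ[k]
    have hs : IsShortestPath a b c rest (shortcut ρ i k) := by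
      refine ⟨hnc', fun ρ₁ h => le_trans ?_ (hρ.2 ρ₁ h)⟩
      rw [pathLength_eq_pairSum, pathLength_eq_pairSum, hu, hu']
      linarith
    have := ih _ (length_shortcut_lt hik hk) hs (fun v hv => hA v (shortcut_subset hv)) rfl
    obtain ⟨w, hw, hw'⟩ := hsum (sep A)
    rwa [hw', pairSum_sep_of_straight (fun v hv => hA v (hmid v hv)) (by linarith), ← hw]
  · push Not at hsc
    have hsc' : ∀ i k, i + 2 ≤ k → k < ρ.length →
        ¬ ∀ ε > 0, IsFreeAt a b c rest (shortcut ρ i k) ε := by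
      intro i k hik hk h
      obtain ⟨ε, hε, h'⟩ := hsc i k hik hk
      exact h' (h ε hε)
    refine Polygonization.pairSum_sep_le hnc.1.1 hnc.1.2.1 fun p q r hs hp hr => ?_
    have hpA := hA p (hs.subset (by simp))
    have hqA := hA q (hs.subset (by simp))
    have hrA := hA r (hs.subset (by simp))
    by_contra hq
    have hneg : ∀ {v}, (v ∈ A ↔ 0 < f v) ∧ f v ≠ 0 → v ∉ A → f v < 0 := fun h h' =>
      lt_of_le_of_ne (not_lt.1 fun h'' => h' (h.1.2 h'')) h.2
    by_cases hbA : b ∈ A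
    · exact not_pattern_of_no_shortcut hb hnc.2 hac hsc' f (hAb.1.1 hbA) hs (hpA.1.1 (hp.2 hbA))
        (hneg hqA fun h => hq (iff_of_true h hbA)) (hrA.1.1 (hr.2 hbA))
    · refine not_pattern_of_no_shortcut hb hnc.2 hac hsc' (-f) ?_ hs ?_ ?_ ?_
      all_goals simp only [AffineMap.coe_neg, Pi.neg_apply, Left.neg_pos_iff, Left.neg_neg_iff]
      · exact hneg hAb hbA
      · exact hneg hpA fun h => hbA (hp.1 h)
      · by_contra h
        exact hq (iff_of_false (fun h' => h (hqA.1.1 h')) hbA)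
      · exact hneg hrA fun h => hbA (hr.1 h)

/-! ### Cutting off a corner -/

/-- A point near `b`, on the side of `a`. -/
def corner (a b c : Pt) (δ η : ℝ) : Pt := b + δ • (a - b) + η • (c - b)

lemma apply_corner (f : Pt →ᵃ[ℝ] ℝ) (a b c : Pt) (δ η : ℝ) :
    f (corner a b c δ η) = δ * f a + (1 - δ - η) * f b + η * f c := by
  have h : corner a b c δ η - b = δ • (a - b) + η • (c - b) := by simp only [corner]; abel
  have h' := congrArg f.linear h
  simp only [map_add, map_smul, affine_sub, smul_eq_mul] at h'
  linear_combination h'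

/-- Close to the edge `ab`, a path that leaves `a` into the triangle meets no other edge. -/
lemma IsBarycentric.eventually_segment_corner {a b c : Pt} {s m t : Pt →ᵃ[ℝ] ℝ}
    (B : IsBarycentric a b c s m t) {δ : ℝ} (hδ : δ ∈ Set.Ioo (0 : ℝ) 1) {p q : Pt}
    (hdis : ∀ x ∈ segment ℝ p q, x ∈ segment ℝ a b → x = a)
    (hend : a ∉ openSegment ℝ p q) :
    ∀ᶠ η in 𝓝[>] (0 : ℝ), ∀ x ∈ segment ℝ a (corner a b c δ η), x ∈ segment ℝ p q → x = a := by
  by_cases ha : a ∈ segment ℝ p q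
  · obtain ⟨w, hw⟩ : ∃ w, segment ℝ p q = segment ℝ a w := by
      rw [← insert_endpoints_openSegment] at ha
      rcases ha with rfl | rfl | ha
      · exact ⟨q, rfl⟩
      · exact ⟨p, segment_symm ℝ p a⟩
      · exact absurd ha hend
    rw [hw]
    -- Measured from `a` by the coordinates `1 - s` and `t`, the two segments can overlap only if
    -- their directions are proportional. This rules out at most one `η`, unless `1 - s w = 0`,
    -- which is excluded below.
    have hne : ∀ᶠ η in 𝓝[>] (0 : ℝ), η * (1 - s w) = t w * (1 - δ) → 1 - s w = 0 := by
      rcases le_or_gt (t w * (1 - δ) / (1 - s w)) 0 with h | h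
      · filter_upwards [self_mem_nhdsWithin] with η hη he
        by_contra hs
        rw [← he, mul_div_cancel_right₀ _ hs] at h
        exact absurd hη h.not_gt
      · filter_upwards [Ioo_mem_nhdsGT h] with η hη he
        by_contra hs
        have := hη.2
        rw [← he, mul_div_cancel_right₀ _ hs] at this
        exact lt_irrefl _ this
    filter_upwards [hne] with η hη x hx hx'
    obtain ⟨u, v, hu, hv, huv, rfl⟩ := hx
    obtain ⟨u', v', hu', hv', huv', he⟩ := hx'
    have hs := congrArg s he
    have ht := congrArg t he
    rw [affine_segment huv, affine_segment huv', apply_corner, B.sa, B.sb, B.sc] at hs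
    rw [affine_segment huv, affine_segment huv', apply_corner, B.ta, B.tb, B.tc] at ht
    have e1 : v' * (1 - s w) = v * (1 - δ) := by linear_combination huv' - huv - hs
    have e2 : v' * t w = v * η := by linear_combination ht
    rcases hv.eq_or_lt with h0 | h0
    · rw [← h0] at huv ⊢
      rw [zero_smul, add_zero, show u = 1 by linarith, one_smul]
    · have h3 : v * (η * (1 - s w) - t w * (1 - δ)) = 0 := by
        linear_combination (-(1 - s w)) * e2 + t w * e1
      have h4 := (mul_eq_zero.1 h3).resolve_left h0.ne'
      rw [hη (sub_eq_zero.1 h4), mul_zero] at e1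
      have := mul_pos h0 (sub_pos.2 hδ.2)
      linarith
  -- Here `ab` and `pq` are disjoint and compact, so `pq` misses a thickening of `ab`, which
  -- contains the pushed segment for small `η`.
  · have hd : Disjoint (segment ℝ a b) (segment ℝ p q) := by
      rw [Set.disjoint_left]
      intro x hx hx'
      exact ha (hdis x hx' hx ▸ hx')
    have hcpt : ∀ x y : Pt, IsCompact (segment ℝ x y) := fun x y => by
      rw [segment_eq_image_lineMap]
      exact isCompact_Icc.image (by fun_prop)
    obtain ⟨r, hr, hdr⟩ := hd.exists_thickenings (hcpt a b) (hcpt p q).isClosed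
    have hlim : Tendsto (fun η : ℝ => η * dist c b) (𝓝[>] 0) (𝓝 0) := by
      have : Tendsto (fun η : ℝ => η * dist c b) (𝓝 0) (𝓝 (0 * dist c b)) :=
        tendsto_id.mul_const _
      rw [zero_mul] at this
      exact this.mono_left nhdsWithin_le_nhds
    filter_upwards [hlim.eventually_lt_const hr, self_mem_nhdsWithin] with η hη hη0 x hx hx'
    exfalso
    refine Set.disjoint_left.1 hdr ?_ (Metric.self_subset_thickening hr _ hx')
    obtain ⟨u, v, hu, hv, huv, rfl⟩ := hx
    rw [Metric.mem_thickening_iff]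
    refine ⟨u • a + v • (corner a b c δ 0), ?_, ?_⟩
    · refine (convex_segment a b) (left_mem_segment ℝ a b) ?_ hu hv huv
      refine ⟨δ, 1 - δ, hδ.1.le, by linarith [hδ.2], by ring, ?_⟩
      simp only [corner]; module
    · rw [dist_add_left, dist_smul₀, Real.norm_of_nonneg hv]
      have : dist (corner a b c δ η) (corner a b c δ 0) = η * dist c b := by
        simp only [corner]
        rw [zero_smul, add_zero, dist_eq_norm, add_sub_cancel_left, norm_smul,
          Real.norm_of_nonneg (le_of_lt hη0), dist_eq_norm]
      rw [this]
      have h0 : 0 ≤ η * dist c b := mul_nonneg (le_of_lt hη0) dist_nonneg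
      nlinarith

/-- A segment that does not cross the edges at `b` and whose endpoints stay away from the corner at
`b` of the triangle `abc` does not enter this corner. -/
lemma IsBarycentric.le_of_mem_segment {a b c : Pt} {s m t : Pt →ᵃ[ℝ] ℝ}
    (B : IsBarycentric a b c s m t) {κ : ℝ} (hκ : κ ≤ 1) {p q : Pt}
    (hdis : ∀ x ∈ segment ℝ p q, x ∈ segment ℝ a b ∪ segment ℝ b c → x = a ∨ x = c)
    (hp : p ∉ triangle a b c ∨ κ ≤ s p + t p) (hq : q ∉ triangle a b c ∨ κ ≤ s q + t q)
    {x : Pt} (hx : x ∈ segment ℝ p q) (hxt : x ∈ triangle a b c) : κ ≤ s x + t x := by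
  by_contra! hlt
  have hx3 := (B.mem x).1 hxt
  have hac : ∀ y, y = a ∨ y = c → s y + t y = 1 := by
    rintro y (rfl | rfl)
    · rw [B.sa, B.ta, add_zero]
    · rw [B.sc, B.tc, zero_add]
  have hsx : 0 < s x := hx3.1.lt_of_ne fun h => by
    have := hac x (hdis x hx (Or.inr (B.mem_bc hx3.2.2 hx3.2.1 h.symm)))
    linarith
  have htx : 0 < t x := hx3.2.2.lt_of_ne fun h => by
    have := hac x (hdis x hx (Or.inl (B.mem_ab hx3.1 hx3.2.1 h.symm)))
    linarith
  have hmx : 0 < m x := by linarith [B.sum x]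
  -- Towards an end, `s + t` reaches `κ` at the end itself or where the segment leaves the triangle:
  -- an exit is `a`, `c` or a point of `ac`, all with `s + t = 1`. An affine function cannot exceed
  -- its value at `x` at both ends.
  have key : ∀ p', p' ∈ segment ℝ p q → (p' ∉ triangle a b c ∨ κ ≤ s p' + t p') →
      s x + t x < s p' + t p' := by
    intro p' hp'q hp'
    obtain ⟨r, hr, hy⟩ : ∃ r ∈ Set.Icc (0 : ℝ) 1, κ ≤ (1 - r) * (s x + t x) + r * (s p' + t p') := by
      rcases hp' with hp' | hp'
      · set h : ℝ → ℝ := fun r => min ((1 - r) * s x + r * s p')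
          (min ((1 - r) * t x + r * t p') ((1 - r) * m x + r * m p')) with hh
        have hc : ContinuousOn h (Set.Icc 0 1) := by
          apply Continuous.continuousOn; fun_prop
        have h0 : 0 ≤ h 0 := by simp [hh, hsx.le, htx.le, hmx.le]
        have h1 : h 1 ≤ 0 := by
          by_contra! hpos
          simp only [hh, sub_self, zero_mul, one_mul, zero_add, lt_min_iff] at hpos
          exact hp' ((B.mem p').2 ⟨hpos.1.le, hpos.2.2.le, hpos.2.1.le⟩)
        obtain ⟨r, hr, hr0⟩ := intermediate_value_Icc' zero_le_one hc ⟨h1, h0⟩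
        refine ⟨r, hr, ?_⟩
        have hr1 : (1 - r) + r = 1 := by ring
        have hy : (1 - r) • x + r • p' ∈ segment ℝ p q :=
          (convex_segment p q) hx hp'q (by linarith [hr.2]) hr.1 hr1
        set y := (1 - r) • x + r • p' with hyd
        have es : s y = (1 - r) * s x + r * s p' := affine_segment hr1
        have et : t y = (1 - r) * t x + r * t p' := affine_segment hr1
        have em : m y = (1 - r) * m x + r * m p' := affine_segment hr1
        have hsum : (1 - r) * (s x + t x) + r * (s p' + t p') = s y + t y := by rw [es, et]; ring
        rw [hsum]
        simp only [hh, ← es, ← et, ← em] at hr0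
        have hys : 0 ≤ s y := hr0 ▸ min_le_left _ _
        have hyt : 0 ≤ t y := hr0 ▸ (min_le_right _ _).trans (min_le_left _ _)
        have hym : 0 ≤ m y := hr0 ▸ (min_le_right _ _).trans (min_le_right _ _)
        rcases min_choice (s y) (min (t y) (m y)) with h | h
        · rw [h] at hr0
          rw [hac y (hdis y hy (Or.inr (B.mem_bc hyt hym hr0)))]; exact hκ
        · rw [h] at hr0
          rcases min_choice (t y) (m y) with h | h
          · rw [h] at hr0
            rw [hac y (hdis y hy (Or.inl (B.mem_ab hys hym hr0)))]; exact hκ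
          · rw [h] at hr0
            linarith [B.sum y]
      · exact ⟨1, by simp, by simpa using hp'⟩
    by_contra! hle
    nlinarith [mul_le_mul_of_nonneg_left hle hr.1]
  have k1 := key p (left_mem_segment ℝ p q) hp
  have k2 := key q (right_mem_segment ℝ p q) hq
  obtain ⟨u, v, hu, hv, huv, rfl⟩ := hx
  rw [affine_segment huv, affine_segment huv] at k1 k2
  have e : u * s p + v * s q + (u * t p + v * t q) = u * (s p + t p) + v * (s q + t q) := by ring
  rw [e] at k1 k2
  have hu' : u = 1 - v := by linarith
  subst hu'
  rcases le_total (s p + t p) (s q + t q) with h | h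
  · nlinarith [mul_le_mul_of_nonneg_left h hv]
  · nlinarith [mul_le_mul_of_nonneg_left h hu]

lemma pathCarrier_four (a p q c : Pt) :
    pathCarrier [a, p, q, c] = segment ℝ a p ∪ segment ℝ p q ∪ segment ℝ q c := by
  rw [pathCarrier_cons_cons, pathCarrier_cons_cons, pathCarrier_cons_cons, pathCarrier_singleton,
    Set.union_eq_self_of_subset_right (t := {c}) (by simpa using right_mem_segment ℝ q c),
    Set.union_assoc]

lemma IsBarycentric.corner_mem {a b c : Pt} {s m t : Pt →ᵃ[ℝ] ℝ}
    (B : IsBarycentric a b c s m t) {δ η : ℝ} (hδ : 0 ≤ δ) (hη : 0 ≤ η) (h : δ + η ≤ 1) :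
    corner a b c δ η ∈ triangle a b c := by
  rw [B.mem, apply_corner, apply_corner, apply_corner, B.sa, B.sb, B.sc, B.ma, B.mb, B.mc, B.ta,
    B.tb, B.tc]
  refine ⟨?_, ?_, ?_⟩ <;> linarith

lemma triangle_symm (a b c : Pt) : triangle c b a = triangle a b c := by
  simp only [triangle]; congr 1; ext; simp; tauto

/-- The path that cuts off a corner free of the polygon is a free path, if it is pushed into the
triangle a little. -/
lemma IsBarycentric.eventually_isFreePath {a b c : Pt} {l : List Pt} {s m t : Pt →ᵃ[ℝ] ℝ}
    (B : IsBarycentric a b c s m t) (hS : IsSimplePolygon (a :: b :: c :: l)) {κ δ : ℝ}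
    (hκ : κ ≤ 1) (hδ : 0 < δ) (hδκ : δ < κ)
    (hl : ∀ p ∈ a :: c :: l, p ∉ triangle a b c ∨ κ ≤ s p + t p) :
    ∀ᶠ η in 𝓝[>] (0 : ℝ),
      IsFreePath a b c l [a, corner a b c δ η, corner c b a δ η, c] := by
  have hδ' : δ ∈ Set.Ioo (0 : ℝ) 1 := ⟨hδ, by linarith⟩
  have hedge : ∀ e ∈ (c :: l).zip (l ++ [a]), ∀ x ∈ segment ℝ e.1 e.2,
      x ∈ segment ℝ a b ∪ segment ℝ b c → x = a ∨ x = c :=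
    fun e he x hx hx' => hS.edge_inter he hx hx'
  have h1 : ∀ᶠ η in 𝓝[>] (0 : ℝ), ∀ e ∈ {e | e ∈ (c :: l).zip (l ++ [a])},
      ∀ x ∈ segment ℝ a (corner a b c δ η), x ∈ segment ℝ e.1 e.2 → x = a := by
    refine (eventually_all_finite (List.finite_toSet _)).2 fun e he =>
      B.eventually_segment_corner hδ' (fun x hx hx' => ?_)
        fun h => Set.disjoint_left.1 (hS.disjoint_openSegment he) h (by simp)
    rcases hedge e he x hx (Or.inl hx') with h | rfl
    · exact h
    · have := B.of_mem_ab hx'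
      rw [B.tc] at this; norm_num at this
  have h2 : ∀ᶠ η in 𝓝[>] (0 : ℝ), ∀ e ∈ {e | e ∈ (c :: l).zip (l ++ [a])},
      ∀ x ∈ segment ℝ c (corner c b a δ η), x ∈ segment ℝ e.1 e.2 → x = c := by
    refine (eventually_all_finite (List.finite_toSet _)).2 fun e he =>
      B.symm.eventually_segment_corner hδ' (fun x hx hx' => ?_)
        fun h => Set.disjoint_left.1 (hS.disjoint_openSegment he) h (by simp)
    rw [segment_symm] at hx'
    rcases hedge e he x hx (Or.inr hx') with rfl | h
    · have := B.of_mem_bc hx'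
      rw [B.sa] at this; norm_num at this
    · exact h
  filter_upwards [h1, h2, Ioo_mem_nhdsGT (sub_pos.2 hδκ)] with η h1 h2 hη
  have hP := B.corner_mem hδ.le hη.1.le (by linarith [hη.2])
  have hQ := B.symm.corner_mem hδ.le hη.1.le (by linarith [hη.2])
  rw [triangle_symm] at hQ
  refine ⟨⟨rfl, rfl, ?_⟩, ?_⟩
  · rw [pathCarrier_four]
    exact Set.union_subset (Set.union_subset
      (segment_subset_triangle (left_mem_triangle _ _ _) hP) (segment_subset_triangle hP hQ))
      (segment_subset_triangle hQ (right_mem_triangle _ _ _))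
  have key : ∀ {a b c : Pt} {s m t : Pt →ᵃ[ℝ] ℝ}, IsBarycentric a b c s m t →
      ∀ x ∈ segment ℝ a (corner a b c δ η), (x ∈ segment ℝ a b → x = a) ∧ x ∉ segment ℝ b c := by
    rintro a b c s m t B x ⟨u, v, hu, hv, huv, rfl⟩
    constructor
    · intro h
      have := B.of_mem_ab h
      rw [affine_segment huv, apply_corner, B.ta, B.tb, B.tc] at this
      have hv0 : v = 0 := by
        have : v * η = 0 := by linarith
        exact (mul_eq_zero.1 this).resolve_right hη.1.ne'
      rw [hv0, show u = 1 by linarith]; simp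
    · intro h
      have := B.of_mem_bc h
      rw [affine_segment huv, apply_corner, B.sa, B.sb, B.sc] at this
      nlinarith [mul_nonneg hv hδ.le]
  rw [pathCarrier_four, boundary_three, pathCarrier_append_singleton]
  rintro x ⟨(hx | hx) | hx, hxb⟩
  · left
    have hk := key B x hx
    rcases hxb with (h | h) | ⟨e, he, h⟩
    · exact hk.1 h
    · exact absurd h hk.2
    · exact h1 e he x hx h
  · exfalso
    have hxt := segment_subset_triangle hP hQ hx
    obtain ⟨u, v, hu, hv, huv, rfl⟩ := hx
    have es : s (u • corner a b c δ η + v • corner c b a δ η) = u * δ + v * η := by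
      rw [affine_segment huv, apply_corner, apply_corner, B.sa, B.sb, B.sc]; ring
    have et : t (u • corner a b c δ η + v • corner c b a δ η) = u * η + v * δ := by
      rw [affine_segment huv, apply_corner, apply_corner, B.ta, B.tb, B.tc]; ring
    have hu1 : u = 1 - v := by linarith
    rcases hxb with (h | h) | ⟨e, he, h⟩
    · have := B.of_mem_ab h
      rw [et, hu1] at this
      rw [hu1] at hu
      nlinarith [mul_nonneg hv hδ.le, mul_nonneg hu hη.1.le, hη.1]
    · have := B.of_mem_bc h
      rw [es, hu1] at this
      rw [hu1] at hu
      nlinarith [mul_nonneg hu hδ.le, mul_nonneg hv hη.1.le, hη.1]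
    -- On the middle segment `s + t` is constantly `δ + η < κ`, out of reach of the other edges.
    · have hmem : ∀ p, (p ∈ c :: l ∨ p ∈ l ++ [a]) → p ∈ a :: c :: l := by
        intro p hp
        simp only [List.mem_cons, List.mem_append, List.not_mem_nil, or_false] at hp ⊢
        tauto
      have hzip := List.of_mem_zip (a := e.1) (b := e.2) he
      have := B.le_of_mem_segment hκ (hedge e he) (hl e.1 (hmem _ (Or.inl hzip.1)))
        (hl e.2 (hmem _ (Or.inr hzip.2))) h hxt
      rw [es, et, hu1] at this
      nlinarith [hη.2]
  · right
    rw [segment_symm] at hx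
    have hk := key B.symm x hx
    rw [segment_symm, segment_symm ℝ b a] at hk
    rcases hxb with (h | h) | ⟨e, he, h⟩
    · exact absurd h hk.2
    · exact hk.1 h
    · exact h2 e he x hx h

/-- In the triangle `abc`, points near `b` have small coordinates at `a` and `c`, and conversely. -/
lemma IsBarycentric.dist_le {a b c : Pt} {s m t : Pt →ᵃ[ℝ] ℝ} (B : IsBarycentric a b c s m t)
    {p : Pt} (hp : p ∈ triangle a b c) : dist p b ≤ (s p + t p) * (dist a b + dist c b) := by
  have h3 := (B.mem p).1 hp
  have h : p - b = s p • (a - b) + t p • (c - b) := by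
    rw [← B.combo_sub p b]; simp
  rw [dist_eq_norm, h]
  refine (norm_add_le _ _).trans ?_
  rw [norm_smul, norm_smul, Real.norm_of_nonneg h3.1, Real.norm_of_nonneg h3.2.2, ← dist_eq_norm,
    ← dist_eq_norm]
  nlinarith [mul_nonneg h3.1 (dist_nonneg (x := c) (y := b)),
    mul_nonneg h3.2.2 (dist_nonneg (x := a) (y := b))]

lemma dist_corner_le (a b c a' b' c' : Pt) {δ η ε : ℝ} (hδ : δ ∈ Set.Ioo (0 : ℝ) 1) (hη : 0 ≤ η)
    (ha : dist a a' ≤ ε) (hb : dist b b' ≤ ε) :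
    dist (corner a b c δ 0) (corner a' b' c' δ η) ≤ ε + η * dist c' b' := by
  have h : corner a b c δ 0 - corner a' b' c' δ η =
      ((1 - δ) • (b - b') + δ • (a - a')) - η • (c' - b') := by
    simp only [corner]; module
  rw [dist_eq_norm, h]
  refine (norm_sub_le _ _).trans (add_le_add ((norm_add_le _ _).trans ?_) ?_)
  · rw [norm_smul, norm_smul, Real.norm_of_nonneg hδ.1.le, Real.norm_of_nonneg (sub_nonneg.2 hδ.2.le),
      ← dist_eq_norm, ← dist_eq_norm]
    nlinarith [hδ.1, hδ.2]
  · rw [norm_smul, Real.norm_of_nonneg hη, ← dist_eq_norm]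

/-- If the triangle `abc` contains no nested double contact at `b`, then a path that cuts off a
small corner at `b` does not cross the polygon. -/
lemma NoNestedContact.exists_isNonCrossingPath {a b c : Pt} {rest : List Pt}
    (hb : b ∉ segment ℝ a c) (h : NoNestedContact a b c rest) :
    ∃ δ ∈ Set.Ioo (0 : ℝ) 1,
      IsNonCrossingPath a b c rest [a, corner a b c δ 0, corner c b a δ 0, c] := by
  obtain ⟨r, hr, hrest⟩ : ∃ r > 0, ∀ p ∈ rest, p ≠ b → r ≤ dist p b := by
    have : ∀ᶠ r in 𝓝[>] (0 : ℝ), ∀ p ∈ {p | p ∈ rest}, p ≠ b → r ≤ dist p b := by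
      refine (eventually_all_finite (List.finite_toSet _)).2 fun p _ => ?_
      by_cases hp : p = b
      · exact Eventually.of_forall fun _ h => absurd hp h
      · filter_upwards [Ioo_mem_nhdsGT (dist_pos.2 hp)] with r hr _ using hr.2.le
    obtain ⟨r, h1, h2⟩ := (this.and self_mem_nhdsWithin).exists
    exact ⟨r, h2, h1⟩
  set M := dist a b + dist c b + 1 with hM
  have hM0 : 0 < M := by positivity
  -- Points of the perturbed triangle with `s + t < κ` lie within `κ * M ≤ r / 2` of its corner,
  -- whereas perturbed vertices not stemming from `b` stay farther away, as `ε' < r / 4`. The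
  -- summand 1 in `M` absorbs the four displacements below 1/4 of the ends of the two sides.
  set κ := min 1 (r / (2 * M)) with hκ
  have hκ0 : 0 < κ := by positivity
  have hκ1 : κ ≤ 1 := min_le_left _ _
  have hδ : κ / 2 ∈ Set.Ioo (0 : ℝ) 1 := ⟨by positivity, by linarith⟩
  refine ⟨κ / 2, hδ, ⟨rfl, rfl, ?_⟩, fun ε hε => ?_⟩
  · have hcm : ∀ {a b c : Pt}, corner a b c (κ / 2) 0 ∈ triangle a b c := fun {a b c} =>
      segment_subset_triangle (left_mem_triangle a b c) (mid_mem_triangle a b c)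
        ⟨κ / 2, 1 - κ / 2, hδ.1.le, by linarith, by ring, by simp only [corner]; module⟩
    have hcm' : corner c b a (κ / 2) 0 ∈ triangle a b c := triangle_symm a b c ▸ hcm
    rw [pathCarrier_four]
    exact Set.union_subset (Set.union_subset
      (segment_subset_triangle (left_mem_triangle _ _ _) hcm) (segment_subset_triangle hcm hcm'))
      (segment_subset_triangle hcm' (right_mem_triangle _ _ _))
  obtain ⟨ε', ⟨hseg, h1, h2, h3⟩, hε'⟩ := (((eventually_notMem_segment hb).and <|
    (show ∀ᶠ x in 𝓝[>] (0 : ℝ), x < ε / 2 from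
      Filter.mem_of_superset (Ioo_mem_nhdsGT (half_pos hε)) fun _ h => h.2).and <|
    (show ∀ᶠ x in 𝓝[>] (0 : ℝ), x < r / 4 from
      Filter.mem_of_superset (Ioo_mem_nhdsGT (by positivity)) fun _ h => h.2).and <|
    (show ∀ᶠ x in 𝓝[>] (0 : ℝ), x < 1 / 4 from
      Filter.mem_of_superset (Ioo_mem_nhdsGT (by positivity)) fun _ h => h.2)).and
      self_mem_nhdsWithin).exists
  obtain ⟨a', b', c', rest', hpert, hS, hnest⟩ := h ε' hε'
  have hpert' := hpert
  simp only [IsPerturbation, List.forall₂_cons] at hpert'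
  obtain ⟨da, db, dc, hd⟩ := hpert'
  obtain ⟨s, m, t, B⟩ := exists_isBarycentric (hS.not_collinear (hseg a' b' c' da db dc))
  have hM' : dist a' b' + dist c' b' ≤ M := by
    have e1 := dist_triangle4 a' a b b'
    have e2 := dist_triangle4 c' c b b'
    rw [dist_comm a' a] at e1
    rw [dist_comm c' c] at e2
    linarith
  have hl : ∀ p ∈ a' :: c' :: rest', p ∉ triangle a' b' c' ∨ κ ≤ s p + t p := by
    intro p hp
    rcases List.mem_cons.1 hp with rfl | hp
    · right; rw [B.sa, B.ta, add_zero]; exact hκ1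
    rcases List.mem_cons.1 hp with rfl | hp
    · right; rw [B.sc, B.tc, zero_add]; exact hκ1
    obtain ⟨n, hn, rfl⟩ := List.getElem_of_mem hp
    have hlen : rest.length = rest'.length := hd.length_eq
    have e1 := List.Forall₂.get hd (hlen ▸ hn) hn
    have e2 := List.Forall₂.get hnest (hlen ▸ hn) hn
    simp only [List.get_eq_getElem] at e1 e2
    by_cases hb' : rest[n]'(hlen ▸ hn) = b
    · exact Or.inl (e2 hb')
    by_cases htri : rest'[n] ∈ triangle a' b' c'
    · right
      have e3 := hrest _ (List.getElem_mem (hlen ▸ hn)) hb'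
      have e4 := B.dist_le htri
      have e5 := dist_triangle4 (rest[n]'(hlen ▸ hn)) rest'[n] b' b
      rw [dist_comm b' b] at e5
      have h3 := (B.mem _).1 htri
      have e6 : (s rest'[n] + t rest'[n]) * (dist a' b' + dist c' b') ≤
          (s rest'[n] + t rest'[n]) * M :=
        mul_le_mul_of_nonneg_left hM' (add_nonneg h3.1 h3.2.2)
      refine (min_le_right _ _).trans ?_
      rw [div_le_iff₀ (by positivity)]
      linarith
    · exact Or.inl htri
  have hsmall : ∀ x y : Pt, ∀ᶠ η in 𝓝[>] (0 : ℝ), η * dist x y < ε / 2 := by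
    intro x y
    have : Tendsto (fun η : ℝ => η * dist x y) (𝓝 0) (𝓝 (0 * dist x y)) := tendsto_id.mul_const _
    rw [zero_mul] at this
    exact (this.mono_left nhdsWithin_le_nhds).eventually_lt_const (half_pos hε)
  obtain ⟨η, hη, hη1, hη2, hη0⟩ := ((B.eventually_isFreePath hS hκ1 hδ.1 (by linarith) hl).and <|
    (hsmall c' b').and <| (hsmall a' b').and self_mem_nhdsWithin).exists
  have hη0 : 0 < η := hη0
  refine ⟨a', b', c', rest', _, hpert.mono (by linarith), hS, ?_, hη⟩
  refine .cons (by linarith) (.cons ?_ (.cons ?_ (.cons (by linarith) .nil)))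
  · exact (dist_corner_le a b c a' b' c' hδ hη0.le da db).trans (by linarith)
  · exact (dist_corner_le c b a c' b' a' hδ hη0.le dc db).trans (by linarith)

lemma dist_le_pairSum_of_head_last {x y : Pt} {l : List Pt} (hx : l.head? = some x)
    (hy : l.getLast? = some y) : dist x y ≤ pairSum dist l := by
  obtain ⟨l', rfl⟩ := List.head?_eq_some_iff.1 hx
  rcases List.eq_nil_or_concat l' with rfl | ⟨mid, z, rfl⟩
  · obtain rfl : x = y := by simpa using hy
    simp
  · rw [List.concat_eq_append] at *
    obtain rfl : z = y := by simpa [List.getLast?_cons] using hy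
    exact dist_le_pairSum x mid z

/-- A twang releases the corner `b`. -/
lemma IsShortestPath.notMem {a b c : Pt} {rest ρ : List Pt} (hb : b ∉ segment ℝ a c)
    (h : NoNestedContact a b c rest) (hρ : IsShortestPath a b c rest ρ) : b ∉ ρ := by
  intro hbρ
  obtain ⟨δ, hδ, hnc⟩ := h.exists_isNonCrossingPath hb
  have h1 := hρ.2 _ hnc
  obtain ⟨L, R, rfl⟩ := List.append_of_mem hbρ
  rw [pathLength_eq_pairSum, pathLength_eq_pairSum, pairSum_append_cons] at h1
  have hL : dist a b ≤ pairSum dist (L ++ [b]) :=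
    dist_le_pairSum_of_head_last (by rw [← hρ.1.1.1]; cases L <;> rfl) (by simp)
  have hR : dist b c ≤ pairSum dist (b :: R) :=
    dist_le_pairSum_of_head_last rfl (by rw [← hρ.1.1.2.1]; simp [List.getLast?_append, List.getLast?_cons])
  simp only [pairSum_cons_cons, pairSum_singleton, add_zero] at h1
  have e1 : ∀ x y z : Pt, dist x (corner x y z δ 0) = (1 - δ) * dist x y := by
    intro x y z
    have : x - corner x y z δ 0 = (1 - δ) • (x - y) := by simp only [corner]; module
    rw [dist_eq_norm, this, norm_smul, Real.norm_of_nonneg (sub_nonneg.2 hδ.2.le), dist_eq_norm]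
  have e2 : dist (corner a b c δ 0) (corner c b a δ 0) = δ * dist a c := by
    have : corner a b c δ 0 - corner c b a δ 0 = δ • (a - c) := by simp only [corner]; module
    rw [dist_eq_norm, this, norm_smul, Real.norm_of_nonneg hδ.1.le, dist_eq_norm]
  rw [e1, e2, dist_comm (corner c b a δ 0) c, e1] at h1
  -- A path through `b` is at least as long as `ab` and `bc` together; cutting the corner replaces a
  -- fraction `δ` of this by the same fraction of the strictly shorter `ac`.
  have h2 : dist a c < dist a b + dist b c := by
    refine (dist_triangle a b c).lt_of_ne fun h => hb ?_
    rw [mem_segment_iff_wbtw, ← dist_add_dist_eq_iff, h]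
  rw [dist_comm c b] at h1
  nlinarith [mul_lt_mul_of_pos_left h2 hδ.1]

/-! ### Subsets cut out by lines -/

open Classical in
/-- The subsets of `S` that a line through no point of `S` cuts out. -/
noncomputable def dichotomies (S : Finset Pt) : Finset (Finset Pt) :=
  S.powerset.filter fun A => ∃ f : Pt →ᵃ[ℝ] ℝ, ∀ p ∈ S, (p ∈ A ↔ 0 < f p) ∧ f p ≠ 0

lemma mem_dichotomies {S A : Finset Pt} : A ∈ dichotomies S ↔
    A ⊆ S ∧ ∃ f : Pt →ᵃ[ℝ] ℝ, ∀ p ∈ S, (p ∈ A ↔ 0 < f p) ∧ f p ≠ 0 := by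
  simp [dichotomies]

-- Four points of the plane are affinely dependent. The two parts of a Radon partition have hulls
-- with a common point, so no line separates them.
open Classical in
lemma card_le_three_of_shatters {S B : Finset Pt} (h : (dichotomies S).Shatters B) :
    B.card ≤ 3 := by
  by_contra! hB
  have hd : ¬ AffineIndependent ℝ (Subtype.val : B → Pt) := by
    intro hi
    have := hi.card_le_finrank_succ
    have h2 := Submodule.finrank_le (vectorSpan ℝ (Set.range (Subtype.val : B → Pt)))
    simp only [Fintype.card_coe] at this
    rw [finrank_euclideanSpace_fin] at h2
    omega
  obtain ⟨I, hI⟩ := Convex.radon_partition hd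
  obtain ⟨u, hu, hBu⟩ := h (t := B.filter fun p => ∃ i ∈ I, (i : Pt) = p) (Finset.filter_subset _ _)
  obtain ⟨x, hx1, hx2⟩ := hI
  obtain ⟨-, f, hf⟩ := mem_dichotomies.1 hu
  obtain ⟨w, hw, hBw⟩ := h.exists_superset
  have hBS : B ⊆ S := hBw.trans (mem_dichotomies.1 hw).1
  have key : ∀ p ∈ B, (p ∈ u ↔ ∃ i ∈ I, (i : Pt) = p) := by
    intro p hp
    have := Finset.ext_iff.1 hBu p
    simp only [Finset.mem_inter, Finset.mem_filter, hp, true_and] at this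
    exact this
  have hp : 0 < f x := by
    have hc : Convex ℝ (f ⁻¹' Set.Ioi 0) := (convex_Ioi 0).affine_preimage f
    refine convexHull_min ?_ hc hx1
    rintro _ ⟨i, hi, rfl⟩
    exact (hf i (hBS i.2)).1.1 ((key i i.2).2 ⟨i, hi, rfl⟩)
  have hn : f x < 0 := by
    have hc : Convex ℝ (f ⁻¹' Set.Iio 0) := (convex_Iio 0).affine_preimage f
    refine convexHull_min ?_ hc hx2
    rintro _ ⟨i, hi, rfl⟩
    have h1 := hf i (hBS i.2)
    refine lt_of_le_of_ne (not_lt.1 fun h0 => ?_) h1.2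
    obtain ⟨j, hj, hji⟩ := (key i i.2).1 (h1.1.2 h0)
    exact hi (Subtype.ext hji ▸ hj)
  exact lt_asymm hp hn

/-- A family has at most as many members as it shatters sets. Shattered sets have 0 to 3 points, and
each of these four sizes contributes at most n³. -/
lemma card_dichotomies_le {S : Finset Pt} (hS : S.Nonempty) :
    (dichotomies S).card ≤ 4 * S.card ^ 3 := by
  classical
  have hsub : (dichotomies S).shatterer ⊆ (Finset.range 4).biUnion fun k => S.powersetCard k := by
    intro B hB
    have hB := Finset.mem_shatterer.1 hB
    have := card_le_three_of_shatters hB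
    obtain ⟨w, hw, hBw⟩ := hB.exists_superset
    simp only [Finset.mem_biUnion, Finset.mem_range, Finset.mem_powersetCard]
    exact ⟨_, by omega, hBw.trans (mem_dichotomies.1 hw).1, rfl⟩
  calc (dichotomies S).card ≤ _ := Finset.card_le_card_shatterer _
    _ ≤ _ := Finset.card_le_card hsub
    _ ≤ ∑ k ∈ Finset.range 4, (S.powersetCard k).card := Finset.card_biUnion_le
    _ ≤ ∑ k ∈ Finset.range 4, S.card ^ 3 := by
        refine Finset.sum_le_sum fun k hk => ?_
        rw [Finset.card_powersetCard]
        exact (Nat.choose_le_pow _ _).trans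
          (Nat.pow_le_pow_right hS.card_pos (by have := Finset.mem_range.1 hk; omega))
    _ = 4 * S.card ^ 3 := by simp

/-! ### The effect of a twang on the crossing numbers -/

/-- An affine function is smaller on a triangle, away from the corner `b`, than at `b`, if it is so
on the opposite side. -/
lemma exists_affine_lt {a b c : Pt} (hb : b ∉ segment ℝ a c) :
    ∃ f : Pt →ᵃ[ℝ] ℝ, (∀ y ∈ segment ℝ a c, f y < f b) ∧
      ∀ y ∈ triangle a b c, y ≠ b → f y < f b := by
  have hcl : IsClosed (segment ℝ a c) := by
    rw [← convexHull_pair]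
    exact (Set.Finite.isCompact_convexHull ℝ (Set.toFinite _)).isClosed
  obtain ⟨g, u, h1, h2⟩ := geometric_hahn_banach_closed_point (convex_segment a c) hcl hb
  have h3 : ∀ y ∈ segment ℝ a c, g y < g b := fun y hy => (h1 y hy).trans h2
  refine ⟨g.toLinearMap.toAffineMap, fun y hy => by simpa using h3 y hy, fun y hy hyb => ?_⟩
  have : triangle a b c = convexJoin ℝ {b} (segment ℝ a c) := by
    rw [triangle, show ({a, b, c} : Set Pt) = insert b {a, c} by ext; simp; tauto,
      convexHull_insert (by simp), convexHull_pair]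
  rw [this, mem_convexJoin] at hy
  obtain ⟨b', hb', z, hz, s, t, hs, ht, hst, rfl⟩ := hy
  obtain rfl : b' = b := by simpa using hb'
  have ht0 : t ≠ 0 := by
    rintro rfl
    have : s = 1 := by linarith
    subst this
    simp at hyb
  have hpos := lt_of_le_of_ne ht ht0.symm
  have := h3 z hz
  simp only [LinearMap.coe_toAffineMap, ContinuousLinearMap.coe_coe, map_add, map_smul,
    smul_eq_mul]
  have : s = 1 - t := by linarith
  subst this
  nlinarith

/-- Proper corners and hairpins enter the argument only through this common property. -/
lemma notMem_segment_of_twang {a b c : Pt} (h : ¬ Collinear ℝ {a, b, c} ∨ (a = c ∧ a ≠ b)) :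
    b ∉ segment ℝ a c := by
  rcases h with h | ⟨rfl, h⟩
  · exact fun hb => h (mem_segment_iff_wbtw.1 hb).collinear
  · simpa using h.symm

/-- Meant for pseudovertices, whose twangs do not require this condition. The perturbations come
from the path, and the condition on them is vacuous. -/
lemma noNestedContact_of_notMem {a b c : Pt} {rest ρ : List Pt} (h : IsShortestPath a b c rest ρ)
    (hb : b ∉ rest) : NoNestedContact a b c rest := by
  intro ε hε
  obtain ⟨a', b', c', rest', ρ', h1, h2, -⟩ := h.1.2 ε hε
  refine ⟨a', b', c', rest', h1, h2, ?_⟩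
  have h3 : List.Forall₂ (fun p q => dist p q ≤ ε) rest rest' := by
    simp only [IsPerturbation, List.forall₂_cons] at h1
    exact h1.2.2.2
  rw [List.forall₂_iff_get] at h3 ⊢
  refine ⟨h3.1, fun i h₁ h₂ hib => absurd ?_ hb⟩
  rw [← hib]
  exact List.get_mem _ _

/-- The data of a twang, with the immediate repetitions in the new path not yet removed. -/
lemma IsTwang.exists_path {S : Finset Pt} {σ σ' : List Pt} {a b c : Pt} (h : IsTwang S σ a b c σ') :
    ∃ rest ρ : List Pt, σ.IsRotated (a :: b :: c :: rest) ∧ b ∉ segment ℝ a c ∧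
      IsShortestPath a b c rest ρ ∧ (∀ p ∈ ρ, p ∈ σ) ∧
      (b ∉ S ∨ (IsDoubleContact σ b ∧ NoNestedContact a b c rest)) ∧
      σ'.Sublist (ρ ++ rest) ∧
      ∀ A : Set Pt, cycCrossings A σ + pairSum (sep A) ρ =
        cycCrossings A σ' + (sep A a b + sep A b c) := by
  classical
  obtain ⟨rest, τ, h1, h2, h3, ⟨ρ, h4, h5, -, hτ⟩, rfl⟩ := h
  have hhead : (ρ.destutter (· ≠ ·)).head? = some a := by rw [head?_destutter_ne, h4.1.1.1]
  have hlast : (ρ.destutter (· ≠ ·)).getLast? = some c := by rw [getLast?_destutter_ne, h4.1.1.2.1]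
  refine ⟨rest, ρ, h1, notMem_segment_of_twang h2, h4, fun p hp => h1.mem_iff.2 (h5 p hp), h3,
    ?_, fun A => ?_⟩
  · rw [hτ]
    exact (List.destutter_sublist _ _).append_right rest
  · have hsum : pairSum (sep A) τ = pairSum (sep A) ρ := by
      rw [hτ]
      exact pairSum_destutter _ (sep_self A) ρ
    rw [← hsum, cycCrossings_congr A h1, cycCrossings_cons]
    rw [← hτ] at hhead hlast
    obtain ⟨t, rfl⟩ : ∃ t, τ = a :: t := by
      cases τ with
      | nil => simp at hhead
      | cons x t => exact ⟨t, by simpa using hhead⟩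
    obtain ⟨τ₀, hτ₀⟩ := List.getLast?_eq_some_iff.1 hlast
    have : cycCrossings A (a :: t ++ rest) =
        pairSum (sep A) (a :: t) + pairSum (sep A) (c :: (rest ++ [a])) := by
      rw [List.cons_append, cycCrossings_cons, hτ₀, ← pairSum_append_cons,
        ← List.singleton_append (l := rest ++ [a]), ← List.append_assoc, ← hτ₀]
      simp
    rw [this]
    simp only [List.cons_append, pairSum_cons_cons]
    omega

lemma IsTwang.subset {S : Finset Pt} {σ σ' : List Pt} {a b c : Pt} (h : IsTwang S σ a b c σ') :
    ∀ p ∈ σ', p ∈ σ := by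
  obtain ⟨rest, ρ, h1, -, -, h4, -, h6, -⟩ := h.exists_path
  intro p hp
  rcases List.mem_append.1 (h6.subset hp) with hp | hp
  · exact h4 p hp
  · exact h1.mem_iff.2 (by simp [hp])

/-- `S'` may exceed `S`: the lines must also avoid the pseudovertices present in `σ`. -/
lemma IsTwang.cycCrossings_le {S S' : Finset Pt} {σ σ' : List Pt} {a b c : Pt}
    (h : IsTwang S σ a b c σ') (hσ : ∀ p ∈ σ, p ∈ S') {A : Finset Pt} (hA : A ∈ dichotomies S') :
    cycCrossings A σ' ≤ cycCrossings A σ := by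
  obtain ⟨rest, ρ, h1, h2, h3, h4, -, -, h7⟩ := h.exists_path
  obtain ⟨-, f, hf⟩ := mem_dichotomies.1 hA
  have := h3.pairSum_sep_le h2 (A := (A : Set Pt)) (f := f)
    (by simpa using hf b (hσ b (h1.mem_iff.2 (by simp))))
    (fun p hp => by simpa using hf p (hσ p (h4 p hp)))
  have := h7 A
  omega

/-- The new path uses points of `σ` in the triangle other than `b`. A line just below `b` leaves
them all on one side, yet it was crossed by the removed edges. -/
lemma IsTwang.exists_cycCrossings_lt {S S' : Finset Pt} {σ σ' : List Pt} {a b c : Pt}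
    (h : IsTwang S σ a b c σ') (hσ : ∀ p ∈ σ, p ∈ S') (hb : b ∈ S) :
    ∃ A ∈ dichotomies S', cycCrossings A σ' < cycCrossings A σ := by
  classical
  obtain ⟨rest, ρ, h1, h2, h3, h4, h5, -, h7⟩ := h.exists_path
  have h5 := (h5.resolve_left (not_not_intro hb)).2
  have hbρ := h3.notMem h2 h5
  obtain ⟨f, hf1, hf2⟩ := exists_affine_lt h2
  -- `θ` is so close to `f b` that no point of `S'` has its value in `[θ, f b)`.
  obtain ⟨θ, hθ, hθS⟩ : ∃ θ < f b, ∀ p ∈ S', f p < f b → f p < θ := by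
    have : ∀ᶠ θ in 𝓝[<] (f b), ∀ p ∈ S', f p < f b → f p < θ := by
      rw [Filter.eventually_all_finset]
      intro p _
      by_cases hp : f p < f b
      · filter_upwards [Ioo_mem_nhdsLT hp] with θ h _ using h.1
      · exact .of_forall fun _ h => absurd h hp
    obtain ⟨θ, h, hθ⟩ := (this.and self_mem_nhdsWithin).exists
    exact ⟨θ, hθ, h⟩
  have hmem : ∀ p, p ∈ S'.filter (fun p => θ < f p) ↔ p ∈ S' ∧ θ < f p := fun p => by simp
  refine ⟨S'.filter fun p => θ < f p, ?_, ?_⟩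
  · refine mem_dichotomies.2 ⟨Finset.filter_subset _ _, f - AffineMap.const ℝ Pt θ, fun p hp => ?_⟩
    simp only [hmem, hp, true_and, AffineMap.coe_sub, Pi.sub_apply, AffineMap.const_apply, sub_pos,
      sub_ne_zero]
    rcases lt_or_ge (f p) (f b) with h | h
    · exact (hθS p hp h).ne
    · exact (hθ.trans_le h).ne'
  · have hbA : b ∈ S'.filter fun p => θ < f p := by
      simp [hθ, hσ b (h1.mem_iff.2 (by simp))]
    have hlow : ∀ p ∈ triangle a b c, p ≠ b → p ∈ σ → p ∉ S'.filter fun p => θ < f p := by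
      intro p hp hpb hpσ hpA
      exact lt_asymm ((hmem p).1 hpA).2 (hθS p (hσ p hpσ) (hf2 p hp hpb))
    have ha := hlow a (left_mem_triangle a b c) (fun h => h2 (h ▸ left_mem_segment ℝ a c))
      (h1.mem_iff.2 (by simp))
    have hc := hlow c (right_mem_triangle a b c) (fun h => h2 (h ▸ right_mem_segment ℝ a c))
      (h1.mem_iff.2 (by simp))
    have hρ : pairSum (sep ↑(S'.filter fun p => θ < f p)) ρ = 0 := by
      refine pairSum_sep_eq_zero (b := a) fun p hp => ?_
      have := hlow p (h3.1.1.2.2 (Or.inl hp)) (fun h => hbρ (h ▸ hp)) (h4 p hp)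
      simp only [Finset.mem_coe]
      tauto
    have := h7 ↑(S'.filter fun p => θ < f p)
    rw [hρ, sep_eq_one (p := a) (q := b) (by simp only [Finset.mem_coe]; tauto)] at this
    omega

/-! ### Counting the twangs of a cascade -/

/-- The total number of crossings decreases with every step of a twang cascade. -/
lemma IsTwangCascade.add_sum_le {S S' : Finset Pt} {T : ℕ} {f : ℕ → List Pt}
    (h : IsTwangCascade S T f) (hS : ∀ p ∈ f 0, p ∈ S) (hSS : S ⊆ S') :
    T + ∑ A ∈ dichotomies S', cycCrossings A (f T) ≤ ∑ A ∈ dichotomies S', cycCrossings A (f 0) := by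
  suffices ∀ n ≤ T, (∀ p ∈ f n, p ∈ S) ∧
      n + ∑ A ∈ dichotomies S', cycCrossings A (f n) ≤ ∑ A ∈ dichotomies S', cycCrossings A (f 0) from
    (this T le_rfl).2
  intro n
  induction n with
  | zero => exact fun _ => ⟨hS, by simp⟩
  | succ n ih =>
    intro hn
    obtain ⟨h1, h2⟩ := ih (by omega)
    obtain ⟨a, b, c, hb, ht⟩ := h n (by omega)
    have h1' : ∀ p ∈ f n, p ∈ S' := fun p hp => hSS (h1 p hp)
    obtain ⟨A, hA, hlt⟩ := ht.exists_cycCrossings_lt h1' (h1 b hb.mem)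
    have := Finset.sum_lt_sum (fun A hA => ht.cycCrossings_le h1' hA) ⟨A, hA, hlt⟩
    exact ⟨fun p hp => h1 p (ht.subset p hp), by omega⟩

lemma IsTwangCascade.le_mul {S S' : Finset Pt} {T m : ℕ} {f : ℕ → List Pt}
    (h : IsTwangCascade S T f) (hS : ∀ p ∈ f 0, p ∈ S) (hSS : S ⊆ S') (hne : S'.Nonempty)
    (hm : ∀ A ∈ dichotomies S', cycCrossings A (f 0) ≤ m) : T ≤ 4 * S'.card ^ 3 * m :=
  calc T ≤ ∑ A ∈ dichotomies S', cycCrossings A (f 0) := by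
        have := h.add_sum_le hS hSS
        omega
    _ ≤ ∑ _A ∈ dichotomies S', m := Finset.sum_le_sum hm
    _ = (dichotomies S').card * m := by simp
    _ ≤ 4 * S'.card ^ 3 * m := Nat.mul_le_mul_right _ (card_dichotomies_le hne)

/-- Equality holds at n = 2, so the factor 4 cannot be lowered. -/
lemma pow_four_le_four_mul_self_pow {n : ℕ} (hn : 0 < n) : n ^ 4 ≤ 4 * n ^ n := by
  rcases lt_or_ge n 4 with h | h
  · interval_cases n <;> norm_num
  · have := Nat.pow_le_pow_right hn h
    omega

lemma nonempty_of_not_collinear {S : Finset Pt} (h : ¬ Collinear ℝ (S : Set Pt)) : S.Nonempty := by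
  by_contra h0
  rw [Finset.not_nonempty_iff_eq_empty] at h0
  subst h0
  simp [collinear_empty] at h

lemma length_le_of_occurrences_le {S : Finset Pt} {K : ℕ} {l : List Pt} (hl : ∀ p ∈ l, p ∈ S)
    (hK : ∀ p, occurrences l p ≤ K) : l.length ≤ S.card * K := by
  classical
  rw [← List.sum_toFinset_count_eq_length]
  calc _ ≤ ∑ _p ∈ l.toFinset, K := Finset.sum_le_sum fun p _ => by
        simpa [occurrences] using hK p
    _ = l.toFinset.card * K := by simp
    _ ≤ _ := Nat.mul_le_mul_right _ (Finset.card_le_card fun p hp => hl p (by simpa using hp))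

lemma IsTwangCascade.le_of_wrap {S : Finset Pt} {K T : ℕ} {f : ℕ → List Pt}
    (hS : ¬ Collinear ℝ (S : Set Pt)) (hw : IsPolygonalWrap S (f 0))
    (hK : ∀ p, occurrences (f 0) p ≤ K) (h : IsTwangCascade S T f) :
    T ≤ 16 * K * S.card ^ S.card := by
  have hne := nonempty_of_not_collinear hS
  have hsub : ∀ p ∈ f 0, p ∈ S := fun p => (hw.1 p).1
  have h1 := h.le_mul hsub (Finset.Subset.refl S) hne (m := S.card * K) fun A _ =>
    (cycCrossings_le_length A _).trans (length_le_of_occurrences_le hsub hK)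
  have h2 := Nat.mul_le_mul_left (4 * K) (pow_four_le_four_mul_self_pow hne.card_pos)
  nlinarith

/-! ### The first wrap of a forward move -/

/-- Every vertex starts a half-open edge, and these are disjoint. -/
lemma IsSimplePolygon.notMem_of_lineMap {a b x : Pt} {l : List Pt} {r : ℝ}
    (h : IsSimplePolygon (a :: b :: l)) (hr : r ∈ Set.Ioo (0 : ℝ) 1)
    (hx : x = AffineMap.lineMap a b r) : x ∉ a :: b :: l := by
  have hab : a ≠ b := by
    have := h.nodup
    rintro rfl
    simp at this
  have hxe : x ∈ halfOpenEdge (a, b) := ⟨r, ⟨hr.1.le, hr.2⟩, hx.symm⟩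
  intro hmem
  obtain ⟨tl, htl⟩ : ∃ tl, cycEdges (a :: b :: l) = (a, b) :: tl := ⟨_, by simp [cycEdges]; rfl⟩
  rw [← map_fst_cycEdges (a :: b :: l), htl, List.map_cons, List.mem_cons] at hmem
  have hd := h.2
  rw [htl, List.pairwise_cons] at hd
  rcases hmem with hxa | hmem
  · have := AffineMap.lineMap_injective ℝ hab
      ((hx.symm.trans hxa).trans (AffineMap.lineMap_apply_zero a b).symm)
    exact hr.1.ne' this
  · obtain ⟨e, he, rfl⟩ := List.mem_map.1 hmem
    exact Set.disjoint_left.1 (hd.1 e he) hxe (left_mem_halfOpenEdge _ _)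

lemma ArePseudovertices.exists_lineMap {P : List Pt} {a b v xm xp : Pt}
    (h : ArePseudovertices P a b v xm xp) : ∃ r s : ℝ, 0 < r ∧ r < s ∧ s < 1 ∧ a ≠ b ∧
      xm = AffineMap.lineMap a b r ∧ xp = AffineMap.lineMap a b s := by
  obtain ⟨x, h1, h2, h3, -⟩ := h
  rw [sbtw_iff_mem_image_Ioo_and_ne] at h1 h2 h3
  obtain ⟨⟨t, ht, rfl⟩, hab⟩ := h1
  obtain ⟨⟨r, hr, rfl⟩, -⟩ := h2
  obtain ⟨⟨s, hs, rfl⟩, -⟩ := h3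
  refine ⟨r * t, t + s * (1 - t), mul_pos hr.1 ht.1, ?_, ?_, hab, ?_, ?_⟩
  · nlinarith [hr.2, hs.1, ht.1, ht.2, mul_pos hs.1 (sub_pos.2 ht.2)]
  · nlinarith [hs.2, ht.2]
  · simp only [AffineMap.lineMap_apply_module']
    module
  · simp only [AffineMap.lineMap_apply_module']
    module

/-- A pseudovertex that occurs once disappears in its twang. -/
lemma IsTwang.notMem {S : Finset Pt} {σ σ' : List Pt} {a b c : Pt} (h : IsTwang S σ a b c σ')
    (hb : List.count b σ ≤ 1) : b ∉ σ' := by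
  obtain ⟨rest, ρ, h1, h2, h3, -, -, h6, -⟩ := h.exists_path
  have hr : b ∉ rest := by
    intro hr
    rw [h1.perm.count_eq, List.count_cons, List.count_cons_self, List.count_cons] at hb
    have := List.count_pos_iff.2 hr
    omega
  intro hb'
  rcases List.mem_append.1 (h6.subset hb') with h | h
  · exact h3.notMem h2 (noNestedContact_of_notMem h3 hr) h
  · exact hr h

/-- A point outside the triangle does not become more frequent in a twang. -/
lemma IsTwang.count_le {S : Finset Pt} {σ σ' : List Pt} {a b c p : Pt} (h : IsTwang S σ a b c σ')
    (hp : p ∉ triangle a b c) : List.count p σ' ≤ List.count p σ := by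
  obtain ⟨rest, ρ, h1, h2, h3, -, -, h6, -⟩ := h.exists_path
  have hρ : List.count p ρ = 0 :=
    List.count_eq_zero.2 fun hp' => hp (h3.1.1.2.2 (Or.inl hp'))
  have := h6.count_le p
  rw [List.count_append, hρ] at this
  rw [h1.perm.count_eq, List.count_cons, List.count_cons, List.count_cons]
  omega

/-- A functional whose maximum over the triangle is attained only at the pseudovertex increases from
`a` along `ab`, hence is larger still at the later point. -/
lemma IsTwang.notMem_triangle {S : Finset Pt} {σ σ' : List Pt} {a b v : Pt} {r s : ℝ} (hr : 0 < r)
    (hrs : r < s) (h : IsTwang S σ a (AffineMap.lineMap a b r) v σ') :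
    AffineMap.lineMap a b s ∉ triangle a (AffineMap.lineMap a b r) v := by
  obtain ⟨rest, ρ, -, hb, -⟩ := h.exists_path
  obtain ⟨f, hf1, hf2⟩ := exists_affine_lt hb
  have ha := hf1 a (left_mem_segment ℝ a v)
  have hfl : ∀ t : ℝ, f (AffineMap.lineMap a b t) = f a + t * (f b - f a) := fun t => by
    rw [AffineMap.apply_lineMap, AffineMap.lineMap_apply_ring']
    ring
  rw [hfl] at ha
  have hpos : 0 < f b - f a := by
    by_contra! h
    nlinarith
  have hlt : f (AffineMap.lineMap a b r) < f (AffineMap.lineMap a b s) := by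
    rw [hfl, hfl]
    nlinarith
  exact fun hmem => lt_asymm hlt (hf2 _ hmem fun h => hlt.ne (by rw [h]))

/-- The pseudovertices of a forward move disappear, and its crossing numbers are bounded by
the number of entries of the polygon with the pseudovertices. -/
lemma IsCascadeStart.exists_superset {S : Finset Pt} {P σ : List Pt} (hP : IsPolygonization S P)
    (h : IsCascadeStart S P σ) : (∀ p ∈ σ, p ∈ S) ∧ ∃ S' : Finset Pt, S ⊆ S' ∧ S'.card ≤ S.card + 2 ∧
      ∀ A ∈ dichotomies S', cycCrossings A σ ≤ S.card + 3 := by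
  classical
  obtain ⟨a, b, u, v, w, xm, xp, -, σ₁, -, -, -, -, ⟨hv, hx, rest, σ₂, hPr, h1, h2⟩, h3⟩ := h
  obtain ⟨r, s, hr, hrs, hs, hab, hxm, hxp⟩ := hx.exists_lineMap
  have hsimple := hP.2.congr hPr
  have hmP : xm ∉ a :: b :: rest := hsimple.notMem_of_lineMap ⟨hr, hrs.trans hs⟩ hxm
  have hpP : xp ∉ a :: b :: rest := hsimple.notMem_of_lineMap ⟨hr.trans hrs, hs⟩ hxp
  have hmp : xm ≠ xp := fun h =>
    hrs.ne (AffineMap.lineMap_injective ℝ hab (hxm.symm.trans (h.trans hxp)))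
  have hv' : v ∈ a :: b :: rest := hPr.mem_iff.1 hv
  have hvm : v ≠ xm := fun h => hmP (h ▸ hv')
  have hvp : v ≠ xp := fun h => hpP (h ▸ hv')
  have hmem : ∀ p ∈ a :: xm :: v :: xp :: b :: rest, p = xm ∨ p = xp ∨ p ∈ S := by
    intro p hp
    have hPS : ∀ p ∈ a :: b :: rest, p ∈ S := fun p hp => (hP.1 p).1 (hPr.mem_iff.2 hp)
    have hvS := hPS v hv'
    simp only [List.mem_cons] at hp hPS
    rcases hp with rfl | rfl | rfl | rfl | rfl | hp
    · simp [hPS]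
    · simp
    · simp [hvS]
    · simp
    · simp [hPS]
    · simp [hPS p (by simp [hp])]
  simp only [List.mem_cons, not_or] at hmP hpP
  have hm0 : xm ∉ σ₂ := by
    refine h1.notMem ?_
    simp [hvm, hmp.symm, Ne.symm hmP.1, Ne.symm hmP.2.1,
      List.count_eq_zero.2 hmP.2.2]
  -- The first twang cannot pass through `xp`, which lies outside its triangle, so `xp` still occurs
  -- at most once when the second twang removes it.
  have hp0 : xp ∉ σ₁ := by
    refine h2.notMem ((h1.count_le ?_).trans ?_)
    · subst hxm hxp
      exact h1.notMem_triangle hr hrs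
    · simp [hvp, hmp, Ne.symm hpP.1, Ne.symm hpP.2.1,
        List.count_eq_zero.2 hpP.2.2]
  have hS' : ∀ p ∈ a :: xm :: v :: xp :: b :: rest, p ∈ insert xm (insert xp S) := fun p hp => by
    simpa using hmem p hp
  have hlen : (a :: b :: rest).length = S.card := by
    rw [← List.toFinset_card_of_nodup hsimple.nodup]
    congr 1
    ext p
    rw [List.mem_toFinset, ← hPr.mem_iff, hP.1]
  refine ⟨fun p hp => ?_, insert xm (insert xp S), fun p hp => by simp [hp], ?_, fun A hA => ?_⟩
  · have hp1 := h3.subset p hp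
    have hp2 := h2.subset p hp1
    rcases hmem p (h1.subset p hp2) with rfl | rfl | h
    · exact absurd hp2 hm0
    · exact absurd hp1 hp0
    · exact h
  · have := Finset.card_insert_le xm (insert xp S)
    have := Finset.card_insert_le xp S
    omega
  · have hS₂ := fun p hp => hS' p (h1.subset p hp)
    have hS₁ := fun p hp => hS₂ p (h2.subset p hp)
    have := h3.cycCrossings_le hS₁ hA
    have := h2.cycCrossings_le hS₂ hA
    have := h1.cycCrossings_le hS' hA
    -- The initial sequence has n + 3 entries: the polygon, two pseudovertices and a second `v`.
    have := cycCrossings_le_length A (a :: xm :: v :: xp :: b :: rest)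
    simp only [List.length_cons] at this hlen
    omega

lemma IsTwangCascade.le_of_forward_move {S : Finset Pt} {P : List Pt} {T : ℕ} {f : ℕ → List Pt}
    (hS : ¬ Collinear ℝ (S : Set Pt)) (hP : IsPolygonization S P) (hf : IsCascadeStart S P (f 0))
    (h : IsTwangCascade S T f) : T ≤ 1728 * S.card ^ S.card := by
  have hne := nonempty_of_not_collinear hS
  obtain ⟨hsub, S', hSS, hcard, hc⟩ := hf.exists_superset hP
  have hn := hne.card_pos
  calc T ≤ 4 * S'.card ^ 3 * (S.card + 3) := h.le_mul hsub hSS (hne.mono hSS) hc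
    -- From n ≥ 1: n + 2 ≤ 3n and n + 3 ≤ 4n.
    _ ≤ 4 * (3 * S.card) ^ 3 * (4 * S.card) := by gcongr <;> omega
    _ = 432 * S.card ^ 4 := by ring
    _ ≤ 432 * (4 * S.card ^ S.card) :=
        Nat.mul_le_mul_left _ (pow_four_le_four_mul_self_pow hn)
    _ = 1728 * S.card ^ S.card := by ring

end Polygonization

theorem mainTheorem8 :
    (∃ C : ℝ, ∀ (S : Finset Polygonization.Pt) (P : List Polygonization.Pt)
        (T : ℕ) (f : ℕ → List Polygonization.Pt),
      ¬ Collinear ℝ (S : Set Polygonization.Pt) →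
      Polygonization.IsPolygonization S P →
      Polygonization.IsCascadeStart S P (f 0) →
      Polygonization.IsTwangCascade S T f →
      (T : ℝ) ≤ C * (S.card : ℝ) ^ S.card) ∧
    (∀ K : ℕ, ∃ C : ℝ, ∀ (S : Finset Polygonization.Pt)
        (T : ℕ) (f : ℕ → List Polygonization.Pt),
      ¬ Collinear ℝ (S : Set Polygonization.Pt) →
      Polygonization.IsPolygonalWrap S (f 0) →
      (∀ p, Polygonization.occurrences (f 0) p ≤ K) →
      Polygonization.IsTwangCascade S T f →
      (T : ℝ) ≤ C * (S.card : ℝ) ^ S.card) := by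
  refine ⟨⟨1728, fun S P T f hS hP hf h => ?_⟩, fun K => ⟨16 * K, fun S T f hS hw hK h => ?_⟩⟩
  · exact_mod_cast h.le_of_forward_move hS hP hf
  · exact_mod_cast h.le_of_wrap hS hw hK
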